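/- Let $Z$ be a real random variable with distribution function $P(x)=\mathbb P(Z\le x)$, and let $-\infty\le p_-<0<p_+\le+\infty$ be such that the characteristic function $u\mapsto\mathbb E[e^{iuZ}]$, $u\in\mathbb R$, extends to an analytic function $\phi_Z$ on the strip $\{z\in\mathbb C: p_-<\operatorname{Im}z<p_+\}$ (for instance, the largest such strip). Let $a\in\left(\tfrac12p_-,\tfrac12p_+\right)\setminus\{0\}$, and put $R_a=0$ if $a>0$ and $R_a=1$ if $a<0$. For an integer $N\ge1$ and a step $h>0$ let $u_n=(n+\tfrac12)h$ and let $$\hat P(x)=R_a-\frac{h\,e^{ax}}{\pi}\,\operatorname{Re}\sum_{n=0}^{N-1}\frac{\phi_Z(u_n+ia)}{i(u_n+ia)}\,e^{-iu_nx},\qquad x\in\mathbb R,$$ be the midpoint-rule (FFT) approximation of the shifted inversion formula $P(x)=R_a-\frac{e^{ax}}{\pi}\int_0^\infty\operatorname{Re}\left(\frac{e^{-iux}\phi_Z(u+ia)}{i(u+ia)}\right)du$. Then $\phi_Z(2ia)$ is real and the following hold. (i) (Exponential decay.) If $B,\ell,\omega>0$ and $U\in\mathbb R$ are such that $|\phi_Z(u+ia)|<Be^{-\ell|u|^\omega}$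 for all real $u$ with $|u|\ge U$, then for all $N\ge1$ and $h>0$ with $Nh\ge U$ and all $x\in\mathbb R$, $$|P(x)-\hat P(x)|\le\frac{Be^{ax}}{\pi\omega}\,\frac{e^{-\ell(Nh)^\omega}}{\ell(Nh)^\omega}+\frac{1+e^{2ax}\phi_Z(2ia)}{e^{2\pi|a|/h}-e^{-2\pi|a|/h}}.$$ (ii) (Power-law decay.) If $B,\omega>0$ and $U\in\mathbb R$ are such that $|\phi_Z(u+ia)|<B|u|^{-\omega}$ for all real $u$ with $|u|\ge U$, $u\neq 0$, then for all $N\ge1$ and $h>0$ with $Nh\ge U$ and all $x\in\mathbb R$, $$|P(x)-\hat P(x)|\le\frac{Be^{ax}}{\pi\omega}\,(Nh)^{-\omega}+\frac{1+e^{2ax}\phi_Z(2ia)}{e^{2\pi|a|/h}-e^{-2\pi|a|/h}}.$$ -/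

import Mathlib

open MeasureTheory

noncomputable section

/-- The horizontal strip `pₗ < Im z < pᵤ` of the complex plane; the bounds may be infinite. -/
def horizontalStrip (pₗ pᵤ : EReal) : Set ℂ :=
  {z | pₗ < (z.im : EReal) ∧ (z.im : EReal) < pᵤ}

/-- `(pₗ, pᵤ)` is a strip of analyticity, containing the origin, of the characteristic function of
the law `μ`, and `φ` is the characteristic function at complex arguments of this strip: it is
analytic there and agrees with `u ↦ ∫ exp (i u x) dμ(x)` on the real line. By the identity theorem
`φ` is determined by `μ` on the strip. The maximal strip of analyticity is a special case. -/
structure IsCharFunOnStrip (μ : Measure ℝ) (pₗ pᵤ : EReal) (φ : ℂ → ℂ) : Prop where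
  neg : pₗ < 0
  pos : 0 < pᵤ
  analytic : AnalyticOnNhd ℂ φ (horizontalStrip pₗ pᵤ)
  eq_charFun : ∀ u : ℝ, φ (u : ℂ) = charFun μ u

/-- Exponential decay of `φ` along the line `Im z = a`, valid from the threshold `U` on. -/
def ExponentialDecay (φ : ℂ → ℂ) (a B l ω U : ℝ) : Prop :=
  ∀ u : ℝ, U ≤ |u| → ‖φ ((u : ℂ) + Complex.I * (a : ℂ))‖ < B * Real.exp (-l * |u| ^ ω)

/-- Power-law decay of `φ` along the line `Im z = a`, valid from the threshold `U` on. -/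
def PowerLawDecay (φ : ℂ → ℂ) (a B ω U : ℝ) : Prop :=
  ∀ u : ℝ, u ≠ 0 → U ≤ |u| → ‖φ ((u : ℂ) + Complex.I * (a : ℂ))‖ < B * |u| ^ (-ω)

/-- The constant `R_a` of the shifted inversion formula (used for `a ≠ 0`). -/
def residueTerm (a : ℝ) : ℝ := if 0 < a then 0 else 1

/-- The nodes `(n + 1/2) h` of the midpoint rule. -/
def midpointNode (h : ℝ) (n : ℕ) : ℝ := ((n : ℝ) + 1 / 2) * h

/-- The approximation of the distribution function: the midpoint rule with `N` nodes and step `h`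
for the shifted inversion formula
`P x = R_a - (exp (a x) / π) ∫₀^∞ Re (exp (-i u x) φ (u + i a) / (i (u + i a))) du`. -/
def cdfApprox (φ : ℂ → ℂ) (a h : ℝ) (N : ℕ) (x : ℝ) : ℝ :=
  residueTerm a - h * Real.exp (a * x) / Real.pi *
    (∑ n ∈ Finset.range N,
      φ ((midpointNode h n : ℂ) + Complex.I * (a : ℂ)) /
          (Complex.I * ((midpointNode h n : ℂ) + Complex.I * (a : ℂ))) *
        Complex.exp (-(Complex.I * (x : ℂ) * (midpointNode h n : ℂ)))).re

/-- The bound for the discretisation error. -/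
def discretisationBound (φ : ℂ → ℂ) (a h x : ℝ) : ℝ :=
  1 / (Real.exp (2 * Real.pi * |a| / h) - Real.exp (-(2 * Real.pi * |a| / h))) *
    (1 + Real.exp (2 * a * x) * (φ (2 * Complex.I * (a : ℂ))).re)

end

/-!
If the characteristic function of `μ` extends analytically to a strip, then `μ` has all the
exponential moments allowed by the strip, so that the extension is the moment generating function at
complex arguments. Hence the damped distribution function `F y = exp (-a y) (P y - R_a)` has the
Fourier transform appearing in the shifted inversion formula. Poisson summation at half-integer
frequencies turns the infinite midpoint sum into `∑ₖ (-1) ^ k F (x + 2πk / h)`. Its terms `k ≠ 0`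
decay geometrically by the Chernoff bounds and make up the discretisation error; the omitted nodes
make up the truncation error, which midpoint convexity compares with an integral.
-/

section

open Filter Topology ProbabilityTheory Complex FourierTransform

/-! ### Exponential moments from an analytic characteristic function -/

section

open fwdDiff
open scoped Nat

theorem integrable_exp_mul_I_sub_one_pow (ν : Measure ℝ) [IsFiniteMeasure ν] (t : ℝ) (m : ℕ) :
    Integrable (fun x : ℝ ↦ (cexp (t * x * I) - 1) ^ m) ν := by
  refine (integrable_const ((2 : ℝ) ^ m)).mono' (by fun_prop) (ae_of_all _ fun x ↦ ?_)
  have hexp : ‖cexp (t * x * I)‖ = 1 := mod_cast norm_exp_ofReal_mul_I (t * x)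
  have htwo : ‖cexp (t * x * I) - 1‖ ≤ 2 := by
    linarith [norm_sub_le (cexp (t * x * I)) 1, norm_one (α := ℂ)]
  rw [norm_pow]
  gcongr

theorem fwdDiff_iter_charFun (ν : Measure ℝ) [IsFiniteMeasure ν] (t b : ℝ) (m : ℕ) :
    (Δ_[1])^[m] (fun r ↦ charFun ν (r * t)) b =
      ∫ x, (cexp (t * x * I) - 1) ^ m * cexp (b * t * x * I) ∂ν := by
  induction m generalizing b with
  | zero => simp [charFun_apply_real]
  | succ m ih =>
    have hint (b : ℝ) :
        Integrable (fun x : ℝ ↦ (cexp (t * x * I) - 1) ^ m * cexp (b * t * x * I)) ν :=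
      (integrable_exp_mul_I_sub_one_pow ν t m).mul_bdd (c := 1) (by fun_prop)
        (ae_of_all _ fun x ↦ mod_cast (norm_exp_ofReal_mul_I (b * t * x)).le)
    rw [Function.iterate_succ_apply', fwdDiff, ih, ih, ← integral_sub (hint _) (hint _)]
    refine integral_congr_ae (ae_of_all _ fun x ↦ ?_)
    have hshift : cexp ((b + 1 : ℝ) * t * x * I) = cexp (t * x * I) * cexp (b * t * x * I) := by
      rw [← Complex.exp_add]
      push_cast
      ring_nf
    linear_combination (cexp (t * x * I) - 1) ^ m * hshift

/-- On the unit circle `(e - 1)² / e = -‖e - 1‖²`, so there is no cancellation in a central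
difference. -/
theorem enorm_central_fwdDiff_iter_charFun (ν : Measure ℝ) [IsFiniteMeasure ν] (t : ℝ) (n : ℕ) :
    ‖(Δ_[1])^[2 * n] (fun r ↦ charFun ν (r * t)) (-n)‖ₑ =
      ∫⁻ x : ℝ, ‖(cexp (t * x * I) - 1) ^ (2 * n)‖ₑ ∂ν := by
  have hpow (x : ℝ) : (cexp (t * x * I) - 1) ^ (2 * n) * cexp ((-n : ℝ) * t * x * I) =
      (-1) ^ n * (‖(cexp (t * x * I) - 1) ^ (2 * n)‖ : ℂ) := by
    have hsq : (cexp (t * x * I) - 1) ^ 2 * cexp (-(t * x * I)) =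
        -(‖cexp (t * x * I) - 1‖ : ℂ) ^ 2 := by
      have hinv : cexp (t * x * I) * cexp (-(t * x * I)) = 1 := by
        rw [← Complex.exp_add, add_neg_cancel, Complex.exp_zero]
      rw [← conj_mul', map_sub, map_one, ← exp_conj]
      simp only [map_mul, conj_ofReal, conj_I, mul_neg]
      linear_combination (cexp (t * x * I) - 1) * hinv
    have hneg : cexp ((-n : ℝ) * t * x * I) = cexp (-(t * x * I)) ^ n := by
      rw [← Complex.exp_nat_mul]
      push_cast
      ring_nf
    rw [hneg, pow_mul, ← mul_pow, hsq, neg_pow, norm_pow, norm_pow, ofReal_pow, ofReal_pow]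
  simp_rw [fwdDiff_iter_charFun, hpow]
  rw [integral_const_mul, integral_complex_ofReal, enorm_mul, enorm_pow, enorm_neg, enorm_one,
    one_pow, one_mul, ← ofReal_integral_norm_eq_lintegral_enorm
      (integrable_exp_mul_I_sub_one_pow ν t (2 * n)), ← ofReal_norm, norm_real,
    Real.norm_of_nonneg (integral_nonneg fun _ ↦ norm_nonneg _)]

theorem fwdDiff_iter_partialSum {𝕜 E : Type*} [NontriviallyNormedField 𝕜] [NormedAddCommGroup E]
    [NormedSpace 𝕜 E] (p : FormalMultilinearSeries 𝕜 𝕜 E) (m : ℕ) (t b : 𝕜) :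
    (Δ_[1])^[m] (fun r ↦ p.partialSum (m + 1) (r * t)) b = t ^ m • m ! • p.coeff m := by
  have hterm (i : ℕ) : (Δ_[1])^[m] (fun r ↦ (r * t) ^ i • p.coeff i) b =
      (Δ_[1])^[m] (fun r : 𝕜 ↦ r ^ i) b • t ^ i • p.coeff i := by
    simp only [fwdDiff_iter_eq_sum_shift, mul_pow, Finset.sum_smul, smul_assoc, mul_smul]
  have hsum : (fun r ↦ p.partialSum (m + 1) (r * t)) =
      ∑ i ∈ Finset.range (m + 1), fun r ↦ (r * t) ^ i • p.coeff i := by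
    ext r
    simp [FormalMultilinearSeries.partialSum]
  rw [hsum, fwdDiff_iter_finsetSum, Finset.sum_apply, Finset.sum_range_succ, Finset.sum_eq_zero,
    zero_add, hterm, fwdDiff_iter_eq_factorial]
  · rw [smul_comm]
    simp [Nat.cast_smul_eq_nsmul]
  · intro i hi
    rw [hterm, fwdDiff_iter_pow_eq_zero_of_lt (Finset.mem_range.1 hi)]
    simp

theorem tendsto_fwdDiff_iter_of_hasFPowerSeriesAt {𝕜 E : Type*} [NontriviallyNormedField 𝕜]
    [NormedAddCommGroup E] [NormedSpace 𝕜 E] {f : 𝕜 → E} {p : FormalMultilinearSeries 𝕜 𝕜 E}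
    (hp : HasFPowerSeriesAt f p 0) (m : ℕ) (b : 𝕜) :
    Tendsto (fun t ↦ (t ^ m)⁻¹ • (Δ_[1])^[m] (fun r ↦ f (r * t)) b) (𝓝[≠] 0)
      (𝓝 (m ! • p.coeff m)) := by
  set R : 𝕜 → E := fun y ↦ f y - p.partialSum (m + 1) y
  have hR (r : 𝕜) : Tendsto (fun t ↦ (t ^ m)⁻¹ • R (r * t)) (𝓝[≠] 0) (𝓝 0) := by
    have hmul : Tendsto (fun t ↦ r * t) (𝓝[≠] 0) (𝓝 0) :=
      ((continuous_const_mul r).tendsto' 0 0 (mul_zero r)).mono_left nhdsWithin_le_nhds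
    have hO : (fun t ↦ R (r * t)) =O[𝓝[≠] 0] fun t ↦ t ^ (m + 1) := by
      have hcomp : (fun t ↦ R (r * t)) =O[𝓝[≠] 0] fun t ↦ (r * t) ^ (m + 1) := by
        simpa [Function.comp_def, R, ← norm_mul, ← norm_pow] using
          (hp.isBigO_sub_partialSum_pow (m + 1)).comp_tendsto hmul
      simp only [mul_pow] at hcomp
      exact hcomp.trans (Asymptotics.isBigO_const_mul_self (r ^ (m + 1)) _ _)
    have hquot : (fun t ↦ (t ^ m)⁻¹ • R (r * t)) =O[𝓝[≠] 0] fun t ↦ t := by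
      refine ((Asymptotics.isBigO_refl (fun t : 𝕜 ↦ (t ^ m)⁻¹) _).smul hO).congr' .rfl ?_
      filter_upwards [self_mem_nhdsWithin] with t ht
      rw [smul_eq_mul, pow_succ, inv_mul_cancel_left₀ (pow_ne_zero m ht)]
    exact hquot.trans_tendsto nhdsWithin_le_nhds
  have hΔR : Tendsto (fun t ↦ (t ^ m)⁻¹ • (Δ_[1])^[m] (fun r ↦ R (r * t)) b) (𝓝[≠] 0) (𝓝 0) := by
    simp only [fwdDiff_iter_eq_sum_shift, Finset.smul_sum]
    rw [show (0 : E) = ∑ _k ∈ Finset.range (m + 1), 0 by simp]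
    refine tendsto_finsetSum _ fun k _ ↦ ?_
    have hk := (hR (b + k • 1)).const_smul ((-1 : ℤ) ^ (m - k) * m.choose k)
    rw [smul_zero] at hk
    exact hk.congr fun t ↦ smul_comm _ _ _
  have hsplit : ∀ t ∈ ({0}ᶜ : Set 𝕜),
      (t ^ m)⁻¹ • (Δ_[1])^[m] (fun r ↦ R (r * t)) b + m ! • p.coeff m =
        (t ^ m)⁻¹ • (Δ_[1])^[m] (fun r ↦ f (r * t)) b := by
    intro t ht
    have hf : (fun r ↦ f (r * t)) = (fun r ↦ R (r * t)) + fun r ↦ p.partialSum (m + 1) (r * t) := by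
      ext r; simp [R]
    rw [hf, fwdDiff_iter_add, Pi.add_apply, smul_add, fwdDiff_iter_partialSum,
      inv_smul_smul₀ (pow_ne_zero m ht)]
  have := (hΔR.add_const (m ! • p.coeff m)).congr' (eventuallyEq_nhdsWithin_of_eqOn hsplit)
  rwa [zero_add] at this

theorem lintegral_enorm_pow_le_of_hasFPowerSeriesAt (ν : Measure ℝ) [IsFiniteMeasure ν]
    {p : FormalMultilinearSeries ℝ ℝ ℂ} (hp : HasFPowerSeriesAt (charFun ν) p 0) (n : ℕ) :
    ∫⁻ x, ‖x ^ (2 * n)‖ₑ ∂ν ≤ ‖(2 * n)! • p.coeff (2 * n)‖ₑ := by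
  set g : ℝ → ℝ → ENNReal := fun t x ↦ ‖(t ^ (2 * n))⁻¹ • (cexp (t * x * I) - 1) ^ (2 * n)‖ₑ
  have hg (x : ℝ) : Tendsto (fun t ↦ g t x) (𝓝[≠] 0) (𝓝 ‖x ^ (2 * n)‖ₑ) := by
    have hderiv : HasDerivAt (fun t : ℝ ↦ cexp (t * x * I)) (x * I) 0 := by
      simpa using (((hasDerivAt_id (0 : ℝ)).ofReal_comp.mul_const (x : ℂ)).mul_const I).cexp
    have hlim := (hderiv.tendsto_slope.pow (2 * n)).enorm
    have hx : ‖((x : ℂ) * I) ^ (2 * n)‖ₑ = ‖x ^ (2 * n)‖ₑ := by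
      simp [← ofReal_norm]
    rw [hx] at hlim
    refine hlim.congr fun t ↦ ?_
    rw [slope_def_module, smul_pow, inv_pow]
    simp only [g, sub_zero, ofReal_zero, zero_mul, Complex.exp_zero]
  calc ∫⁻ x, ‖x ^ (2 * n)‖ₑ ∂ν
      = ∫⁻ x, liminf (fun t ↦ g t x) (𝓝[≠] 0) ∂ν := by simp_rw [fun x ↦ (hg x).liminf_eq]
    _ ≤ liminf (fun t ↦ ∫⁻ x, g t x ∂ν) (𝓝[≠] 0) := lintegral_liminf_le fun t ↦ by fun_prop
    _ = ‖(2 * n)! • p.coeff (2 * n)‖ₑ := by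
      refine Tendsto.liminf_eq ?_
      convert! (tendsto_fwdDiff_iter_of_hasFPowerSeriesAt hp (2 * n) (-n)).enorm using 2 with t
      simp_rw [g, enorm_smul]
      rw [lintegral_const_mul _ (by fun_prop), enorm_central_fwdDiff_iter_charFun]

theorem integrable_cosh_of_hasFPowerSeriesOnBall (ν : Measure ℝ) [IsFiniteMeasure ν]
    {p : FormalMultilinearSeries ℝ ℝ ℂ} {r : ENNReal}
    (hp : HasFPowerSeriesOnBall (charFun ν) p 0 r) {s : NNReal} (hs : s < r) :
    Integrable (fun x : ℝ ↦ Real.cosh (s * x)) ν := by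
  have hsum : Summable fun n : ℕ ↦ ‖p (2 * n)‖ * (s : ℝ) ^ (2 * n) :=
    (p.summable_norm_mul_pow (hs.trans_le hp.r_le)).comp_injective
      (mul_right_injective₀ two_ne_zero)
  have hcosh (x : ℝ) : ‖Real.cosh (s * x)‖ₑ =
      ∑' n : ℕ, ‖(s : ℝ) ^ (2 * n) / (2 * n)!‖ₑ * ‖x ^ (2 * n)‖ₑ := by
    have hterm (n : ℕ) : 0 ≤ (s * x) ^ (2 * n) / ((2 * n)! : ℝ) :=
      div_nonneg (Even.pow_nonneg (even_two_mul n) _) (by positivity)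
    rw [Real.enorm_of_nonneg (Real.cosh_pos _).le, ← (Real.hasSum_cosh _).tsum_eq,
      ENNReal.ofReal_tsum_of_nonneg hterm (Real.hasSum_cosh _).summable]
    refine tsum_congr fun n ↦ ?_
    rw [← enorm_mul, ← Real.enorm_of_nonneg (hterm n), mul_pow, div_mul_eq_mul_div]
  have hmoment (n : ℕ) : ‖(s : ℝ) ^ (2 * n) / (2 * n)!‖ₑ * ∫⁻ x, ‖x ^ (2 * n)‖ₑ ∂ν ≤
      ENNReal.ofReal (‖p (2 * n)‖ * (s : ℝ) ^ (2 * n)) := by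
    refine (mul_le_mul_right (lintegral_enorm_pow_le_of_hasFPowerSeriesAt ν
      hp.hasFPowerSeriesAt n) _).trans_eq ?_
    rw [← Nat.cast_smul_eq_nsmul ℝ, enorm_smul, ← mul_assoc, ← enorm_mul,
      div_mul_cancel₀ _ (by positivity), Real.enorm_of_nonneg (by positivity), ← ofReal_norm,
      ← ENNReal.ofReal_mul (by positivity), FormalMultilinearSeries.norm_apply_eq_norm_coef,
      mul_comm]
  refine ⟨by fun_prop, ?_⟩
  calc ∫⁻ x, ‖Real.cosh (s * x)‖ₑ ∂ν
      = ∑' n : ℕ, ‖(s : ℝ) ^ (2 * n) / (2 * n)!‖ₑ * ∫⁻ x, ‖x ^ (2 * n)‖ₑ ∂ν := by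
        simp_rw [hcosh]
        rw [lintegral_tsum fun n ↦ by fun_prop]
        exact tsum_congr fun n ↦ lintegral_const_mul _ (by fun_prop)
    _ ≤ ∑' n : ℕ, ENNReal.ofReal (‖p (2 * n)‖ * (s : ℝ) ^ (2 * n)) := ENNReal.tsum_le_tsum hmoment
    _ < ⊤ := by
        rw [← ENNReal.ofReal_tsum_of_nonneg (fun n ↦ by positivity) hsum]
        exact ENNReal.ofReal_lt_top

theorem integrable_exp_of_hasFPowerSeriesOnBall_charFun (ν : Measure ℝ) [IsFiniteMeasure ν]
    {p : FormalMultilinearSeries ℝ ℝ ℂ} {r : ENNReal}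
    (hp : HasFPowerSeriesOnBall (charFun ν) p 0 r) {t : ℝ} (ht : ‖t‖ₑ < r) :
    Integrable (fun x ↦ Real.exp (t * x)) ν := by
  have hcosh := integrable_cosh_of_hasFPowerSeriesOnBall ν hp (s := ‖t‖₊) ht
  refine (hcosh.const_mul 2).mono' (by fun_prop) (ae_of_all _ fun x ↦ ?_)
  have hcosh_abs : Real.cosh (‖t‖₊ * x) = Real.cosh (t * x) := by
    rw [← Real.cosh_abs (t * x), ← Real.cosh_abs, abs_mul, abs_mul, coe_nnnorm, Real.norm_eq_abs,
      abs_abs]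
  rw [Real.norm_of_nonneg (Real.exp_pos _).le, hcosh_abs, Real.cosh_eq]
  linarith [Real.exp_pos (-(t * x))]

end

theorem charFun_tilted_mul (μ : Measure ℝ) (c u : ℝ) :
    charFun (μ.tilted (c * ·)) u = complexMGF id μ (c + u * I) / mgf id μ c := by
  rw [charFun_apply_real, integral_tilted, complexMGF, div_eq_inv_mul, ← integral_const_mul]
  refine integral_congr_ae (ae_of_all _ fun x ↦ ?_)
  simp only [mgf, id, real_smul, ofReal_div, ofReal_exp, add_mul, Complex.exp_add]
  push_cast
  ring_nf

theorem mem_integrableExpSet_of_differentiableOn_ball (μ : Measure ℝ) {G : ℂ → ℂ} {c r : ℝ}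
    (hG : DifferentiableOn ℂ G (Metric.ball (c : ℂ) r)) (hc : c ∈ integrableExpSet id μ)
    (hGc : Set.EqOn G (complexMGF id μ) {z | z.re = c}) {t : ℝ} (ht : |t - c| < r) :
    t ∈ integrableExpSet id μ := by
  obtain ⟨s, hts, hsr⟩ := exists_between ht
  lift s to NNReal using (abs_nonneg _).trans hts.le
  set H : ℂ → ℂ := fun w ↦ G (c + w * I) / mgf id μ c
  have hchar : charFun (μ.tilted (c * ·)) = H ∘ ofRealCLM := by
    ext u
    have hu : G (c + u * I) = complexMGF id μ (c + u * I) := hGc (by simp)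
    simp only [charFun_tilted_mul, Function.comp_apply, ofRealCLM_apply, H, hu]
  have hH : DifferentiableOn ℂ H (Metric.closedBall 0 s) := by
    refine (hG.comp (by fun_prop) fun w hw ↦ ?_).div_const _
    simp only [Metric.mem_closedBall, dist_zero_right] at hw
    simpa using hw.trans_lt hsr
  have hseries := (hH.hasFPowerSeriesOnBall
    (mod_cast (abs_nonneg _).trans_lt hts)).restrictScalars (𝕜 := ℝ)
  rw [← map_zero ofRealCLM] at hseries
  have hseries' := hseries.compContinuousLinearMap
  rw [← hchar, ← ofReal_norm, ofRealCLM_norm, ENNReal.ofReal_one, div_one] at hseries'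
  have hexp := integrable_exp_of_hasFPowerSeriesOnBall_charFun _ hseries' (t := t - c)
    (by simpa [← ofReal_norm, ENNReal.ofReal_lt_coe_iff] using hts)
  rw [integrable_tilted_iff (f := (c * ·)) hc] at hexp
  refine hexp.congr (ae_of_all _ fun x ↦ ?_)
  simp only [smul_eq_mul, ← Real.exp_add, id]
  ring_nf

theorem eqOn_complexMGF_of_analyticOnNhd_ball (μ : Measure ℝ) {G : ℂ → ℂ} {c r : ℝ} (hr : 0 < r)
    (hG : AnalyticOnNhd ℂ G (re ⁻¹' Metric.ball c r)) (hc : c ∈ integrableExpSet id μ)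
    (hGc : Set.EqOn G (complexMGF id μ) {z | z.re = c}) :
    Metric.ball c r ⊆ integrableExpSet id μ ∧
      Set.EqOn G (complexMGF id μ) (re ⁻¹' Metric.ball c r) := by
  have hsub : Metric.ball c r ⊆ integrableExpSet id μ := fun t ht ↦
    mem_integrableExpSet_of_differentiableOn_ball μ (r := r)
      (hG.differentiableOn.mono fun z hz ↦ (abs_re_le_norm (z - c)).trans_lt
        (by simpa [dist_eq] using hz)) hc hGc ht
  have hint : Metric.ball c r ⊆ interior (integrableExpSet id μ) :=
    interior_maximal hsub Metric.isOpen_ball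
  have hline : ∃ᶠ z in 𝓝[≠] (c : ℂ), G z = complexMGF id μ z := by
    have hvert : Tendsto (fun y : ℝ ↦ (c : ℂ) + y * I) (𝓝[≠] 0) (𝓝[≠] (c : ℂ)) := by
      refine tendsto_nhdsWithin_iff.2 ⟨?_, ?_⟩
      · refine (Continuous.tendsto' (by fun_prop) _ _ (by simp)).mono_left nhdsWithin_le_nhds
      · filter_upwards [self_mem_nhdsWithin] with y hy
        simpa using hy
    exact hvert.frequently (Frequently.of_forall fun y ↦ hGc (by simp))
  refine ⟨hsub, hG.eqOn_of_preconnected_of_frequently_eq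
    (analyticOnNhd_complexMGF.mono fun z hz ↦ hint hz) ?_ (by simpa using hr) hline⟩
  exact ((convex_ball c r).linear_preimage reLm).isPreconnected

theorem eqOn_complexMGF_of_analyticOnNhd (μ : Measure ℝ) [IsFiniteMeasure μ] {G : ℂ → ℂ}
    {s : Set ℝ} (hs : IsOpen s) (hs' : IsPreconnected s) (h0 : 0 ∈ s)
    (hG : AnalyticOnNhd ℂ G (re ⁻¹' s)) (hG0 : ∀ u : ℝ, G (u * I) = charFun μ u) :
    s ⊆ integrableExpSet id μ ∧ Set.EqOn G (complexMGF id μ) (re ⁻¹' s) := by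
  set A : Set ℝ :=
    {t | t ∈ s ∧ t ∈ integrableExpSet id μ ∧ Set.EqOn G (complexMGF id μ) {z | z.re = t}}
  have hstep {c r : ℝ} (hc : c ∈ A) (hr : Metric.ball c r ⊆ s) : Metric.ball c r ⊆ A := by
    intro t ht
    obtain ⟨hexp, heq⟩ := eqOn_complexMGF_of_analyticOnNhd_ball μ (Metric.pos_of_mem_ball ht)
      (hG.mono (Set.preimage_mono hr)) hc.2.1 hc.2.2
    exact ⟨hr ht, hexp ht, heq.mono fun z hz ↦ by rwa [Set.mem_preimage, hz]⟩
  have hA0 : 0 ∈ A := by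
    refine ⟨h0, by simp [integrableExpSet], fun z hz ↦ ?_⟩
    have hz' : z = z.im * I := Complex.ext (by simpa using hz) (by simp)
    rw [hz', hG0, complexMGF_id_mul_I]
  have hAopen : IsOpen A := Metric.isOpen_iff.2 fun c hc ↦
    let ⟨r, hr, hrs⟩ := Metric.isOpen_iff.1 hs c hc.1
    ⟨r, hr, hstep hc hrs⟩
  have hAclosed : closure A ∩ s ⊆ A := by
    rintro t ⟨htA, hts⟩
    obtain ⟨r, hr, hrs⟩ := Metric.isOpen_iff.1 hs t hts
    obtain ⟨c, hc, htc⟩ := Metric.mem_closure_iff.1 htA (r / 2) (half_pos hr)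
    refine hstep hc ((Metric.ball_subset_ball' ?_).trans hrs) htc
    rw [dist_comm]
    linarith
  have hsA : s ⊆ A := hs'.subset_of_closure_inter_subset hAopen ⟨0, h0, hA0⟩ hAclosed
  exact ⟨fun t ht ↦ (hsA ht).2.1, fun z hz ↦ (hsA hz).2.2 rfl⟩

theorem IsCharFunOnStrip.eq_complexMGF {μ : Measure ℝ} [IsFiniteMeasure μ] {pₗ pᵤ : EReal}
    {φ : ℂ → ℂ} (hφ : IsCharFunOnStrip μ pₗ pᵤ φ) {b : ℝ} (hl : pₗ < b) (hu : b < pᵤ) :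
    -b ∈ integrableExpSet id μ ∧ ∀ u : ℝ, φ (u + I * b) = complexMGF id μ (-(b - u * I)) := by
  let s : Set ℝ := (fun t ↦ ((-t : ℝ) : EReal)) ⁻¹' Set.Ioo pₗ pᵤ
  have hcont : Continuous fun t : ℝ ↦ ((-t : ℝ) : EReal) :=
    continuous_coe_real_ereal.comp continuous_neg
  have hanti : Antitone fun t : ℝ ↦ ((-t : ℝ) : EReal) := fun t t' h ↦
    EReal.coe_le_coe_iff.2 (neg_le_neg h)
  have hG : AnalyticOnNhd ℂ (fun z ↦ φ (-(I * z))) (re ⁻¹' s) :=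
    hφ.analytic.comp (fun z _ ↦ by fun_prop) fun z hz ↦ by simpa [horizontalStrip, s] using hz
  obtain ⟨hint, heq⟩ := eqOn_complexMGF_of_analyticOnNhd μ (isOpen_Ioo.preimage hcont)
    (Set.ordConnected_Ioo.preimage_anti hanti).isPreconnected (by simp [hφ.neg, hφ.pos]) hG
    fun u ↦ by
      rw [← hφ.eq_charFun]
      congr 1
      linear_combination (-(u : ℂ)) * I_mul_I
  have hb : -b ∈ s := by simp [s, hl, hu]
  refine ⟨hint hb, fun u ↦ ?_⟩
  rw [← heq (x := -(b - u * I)) (by simpa [s] using hb)]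
  congr 1
  linear_combination (u : ℂ) * I_mul_I

theorem lt_and_lt_two_mul_of_div_two_lt {p : EReal} (hp : p < 0) {a : ℝ} (ha : p / 2 < a) :
    p < a ∧ p < (2 * a : ℝ) := by
  have hp2 : p < (2 * a : ℝ) := by
    rw [mul_comm]
    exact_mod_cast (EReal.div_lt_iff (by norm_num) (EReal.coe_ne_top 2)).1 ha
  refine ⟨?_, hp2⟩
  rcases le_total 0 a with h | h
  · exact hp.trans_le (by exact_mod_cast h)
  · exact hp2.trans_le (by exact_mod_cast (by linarith : 2 * a ≤ a))

theorem lt_and_two_mul_lt_of_lt_div_two {p : EReal} (hp : 0 < p) {a : ℝ} (ha : a < p / 2) :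
    a < p ∧ (2 * a : ℝ) < p := by
  have hp2 : (2 * a : ℝ) < p := by
    rw [mul_comm]
    exact_mod_cast (EReal.lt_div_iff (by norm_num) (EReal.coe_ne_top 2)).1 ha
  refine ⟨?_, hp2⟩
  rcases le_total 0 a with h | h
  · exact lt_of_le_of_lt (by exact_mod_cast (by linarith : a ≤ 2 * a)) hp2
  · exact lt_of_le_of_lt (by exact_mod_cast h) hp

/-! ### Alternating sums and midpoint sums -/

theorem abs_tsum_neg_one_pow_mul_le {d : ℕ → ℝ} {D q : ℝ} (hq0 : 0 < q) (hq1 : q < 1)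
    (hd0 : ∀ n, 0 ≤ d n) (hd : ∀ n, d n ≤ D * q ^ (n + 1)) :
    |∑' n, (-1) ^ n * d n| ≤ D * (q / (1 - q ^ 2)) := by
  have hD : 0 ≤ D := nonneg_of_mul_nonneg_left ((hd0 0).trans (hd 0)) (by positivity)
  have hgeo : HasSum (fun k : ℕ ↦ D * q * (q ^ 2) ^ k) (D * (q / (1 - q ^ 2))) := by
    rw [← mul_div_assoc, div_eq_mul_inv]
    exact (hasSum_geometric_of_lt_one (by positivity) (by nlinarith)).mul_left _
  have heven (k : ℕ) : d (2 * k) ≤ D * q * (q ^ 2) ^ k :=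
    (hd _).trans_eq (by rw [pow_succ, pow_mul]; ring)
  have hodd (k : ℕ) : d (2 * k + 1) ≤ D * q * (q ^ 2) ^ k := calc
    d (2 * k + 1) ≤ D * q ^ (2 * k + 1 + 1) := hd _
    _ ≤ D * q ^ (2 * k + 1) := by
      gcongr D * ?_
      exact pow_le_pow_of_le_one hq0.le hq1.le (Nat.le_succ _)
    _ = D * q * (q ^ 2) ^ k := by rw [pow_succ, pow_mul]; ring
  have hevens : Summable fun k ↦ d (2 * k) := .of_nonneg_of_le (fun k ↦ hd0 _) heven hgeo.summable
  have hodds : Summable fun k ↦ d (2 * k + 1) := .of_nonneg_of_le (fun k ↦ hd0 _) hodd hgeo.summable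
  have hsplit : ∑' n, (-1) ^ n * d n = ∑' k, d (2 * k) - ∑' k, d (2 * k + 1) := by
    have hsign_even (k : ℕ) : (-1) ^ (2 * k) * d (2 * k) = d (2 * k) := by simp
    have hsign_odd (k : ℕ) : (-1) ^ (2 * k + 1) * d (2 * k + 1) = -d (2 * k + 1) := by
      simp [pow_succ]
    rw [← tsum_even_add_odd (by simpa only [hsign_even] using hevens)
      (by simpa only [hsign_odd] using hodds.neg)]
    simp only [hsign_even, hsign_odd, tsum_neg, sub_eq_add_neg]
  rw [hsplit]
  exact abs_sub_le_of_nonneg_of_le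
    (tsum_nonneg fun _ ↦ hd0 _) (hasSum_le heven hevens.hasSum hgeo)
    (tsum_nonneg fun _ ↦ hd0 _) (hasSum_le hodd hodds.hasSum hgeo)

theorem abs_tsum_neg_one_zpow_mul_sub_le {c : ℤ → ℝ} {D q : ℝ} (hq0 : 0 < q) (hq1 : q < 1)
    (hc0 : ∀ k, 0 ≤ c k) (hc : ∀ n : ℕ, c (n + 1) + c (-(n + 1)) ≤ D * q ^ (n + 1)) :
    |∑' k : ℤ, (-1) ^ k * c k - c 0| ≤ D * (q / (1 - q ^ 2)) := by
  have hgeo : Summable fun n : ℕ ↦ D * q ^ (n + 1) :=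
    ((summable_nat_add_iff 1).2 (summable_geometric_of_lt_one hq0.le hq1)).mul_left _
  have hnorm (k : ℤ) : ‖(-1) ^ k * c k‖ = c k := by
    rw [norm_mul, Real.norm_eq_abs, abs_neg_one_zpow, one_mul, Real.norm_of_nonneg (hc0 k)]
  have hpos : Summable fun n : ℕ ↦ (-1) ^ (n + 1 : ℤ) * c (n + 1) :=
    .of_norm_bounded hgeo fun n ↦ by linarith [hnorm (n + 1), hc n, hc0 (-(n + 1))]
  have hneg : Summable fun n : ℕ ↦ (-1) ^ (-(n + 1) : ℤ) * c (-(n + 1)) :=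
    .of_norm_bounded hgeo fun n ↦ by linarith [hnorm (-(n + 1)), hc n, hc0 (n + 1)]
  have hsplit : ∑' k : ℤ, (-1) ^ k * c k - c 0 =
      -∑' n : ℕ, (-1) ^ n * (c (n + 1) + c (-(n + 1))) := by
    rw [tsum_of_add_one_of_neg_add_one (f := fun k : ℤ ↦ (-1) ^ k * c k) hpos hneg, ← tsum_neg,
      zpow_zero, one_mul, add_right_comm, add_sub_cancel_right, ← hpos.tsum_add hneg]
    refine tsum_congr fun n ↦ ?_
    rw [zpow_neg, ← inv_zpow, inv_neg_one, zpow_add_one₀ (by norm_num), zpow_natCast]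
    ring
  rw [hsplit, abs_neg]
  exact abs_tsum_neg_one_pow_mul_le hq0 hq1 (fun n ↦ add_nonneg (hc0 _) (hc0 _)) hc

theorem two_mul_mul_midpoint_le_sub_of_convexOn {g G : ℝ → ℝ} {m d : ℝ} (hd : 0 ≤ d)
    (hg : ConvexOn ℝ (Set.Icc (m - d) (m + d)) g)
    (hG : ∀ x ∈ Set.Icc (m - d) (m + d), HasDerivAt G (g x) x) :
    2 * d * g m ≤ G (m + d) - G (m - d) := by
  have hmem {s : ℝ} (hs : s ∈ Set.Icc 0 d) :
      m - s ∈ Set.Icc (m - d) (m + d) ∧ m + s ∈ Set.Icc (m - d) (m + d) := by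
    constructor <;> constructor <;> linarith [hs.1, hs.2]
  have hderiv {s : ℝ} (hs : s ∈ Set.Icc 0 d) :
      HasDerivAt (fun s ↦ G (m + s) - G (m - s) - 2 * s * g m)
        (g (m + s) + g (m - s) - 2 * g m) s := by
    have hleft := (hG _ (hmem hs).1).comp s ((hasDerivAt_id s).const_sub m)
    have hright := (hG _ (hmem hs).2).comp s ((hasDerivAt_id s).const_add m)
    convert! (hright.sub hleft).sub (((hasDerivAt_id s).const_mul 2).mul_const (g m)) using 1
    ring
  have hmono : MonotoneOn (fun s ↦ G (m + s) - G (m - s) - 2 * s * g m) (Set.Icc 0 d) := by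
    refine monotoneOn_of_hasDerivWithinAt_nonneg (convex_Icc 0 d)
      (fun s hs ↦ (hderiv hs).continuousAt.continuousWithinAt)
      (fun s hs ↦ (hderiv (interior_subset hs)).hasDerivWithinAt) fun s hs ↦ ?_
    obtain ⟨hleft, hright⟩ := hmem (interior_subset hs)
    have hmid := hg.2 hleft hright one_half_pos.le one_half_pos.le (add_halves 1)
    rw [show (1 / 2 : ℝ) • (m - s) + (1 / 2 : ℝ) • (m + s) = m by simp only [smul_eq_mul]; ring,
      smul_eq_mul, smul_eq_mul] at hmid
    linarith
  simpa using hmono (Set.left_mem_Icc.2 hd) (Set.right_mem_Icc.2 hd) hd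

theorem midpointNode_pos {h : ℝ} (hh : 0 < h) (n : ℕ) : 0 < midpointNode h n := by
  unfold midpointNode
  positivity

theorem mul_le_midpointNode_add {h : ℝ} (hh : 0 ≤ h) (N j : ℕ) :
    N * h ≤ midpointNode h (N + j) := by
  unfold midpointNode
  push_cast
  gcongr
  linarith [Nat.cast_nonneg (α := ℝ) j]

theorem sum_midpoint_tail_le_of_convexOn {g Φ : ℝ → ℝ} (hg : ConvexOn ℝ (Set.Ioi 0) g)
    (hΦ : ∀ x, 0 < x → HasDerivAt Φ (-g x) x) (hΦ_nonneg : ∀ x, 0 < x → 0 ≤ Φ x)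
    {h : ℝ} (hh : 0 < h) {N : ℕ} (hN : 0 < N) (m : ℕ) :
    ∑ j ∈ Finset.range m, h * g (midpointNode h (N + j)) ≤ Φ (N * h) := by
  have hpos (j : ℕ) : 0 < (N + j : ℝ) * h := by positivity
  have hstep (j : ℕ) : h * g (midpointNode h (N + j)) ≤
      Φ ((N + j : ℝ) * h) - Φ ((N + (j + 1 : ℕ) : ℝ) * h) := by
    have hleft : midpointNode h (N + j) - h / 2 = (N + j : ℝ) * h := by
      unfold midpointNode; push_cast; ring
    have hright : midpointNode h (N + j) + h / 2 = (N + (j + 1 : ℕ) : ℝ) * h := by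
      unfold midpointNode; push_cast; ring
    have hsub : Set.Icc (midpointNode h (N + j) - h / 2) (midpointNode h (N + j) + h / 2) ⊆
        Set.Ioi 0 := fun x hx ↦ (hpos j).trans_le (hleft ▸ hx.1)
    have hmid := two_mul_mul_midpoint_le_sub_of_convexOn (G := fun x ↦ -Φ x) (half_pos hh).le
      (hg.subset hsub (convex_Icc _ _)) fun x hx ↦ by
        simpa only [neg_neg] using (hΦ x (hsub hx)).fun_neg
    rw [hleft, hright] at hmid
    linarith
  calc ∑ j ∈ Finset.range m, h * g (midpointNode h (N + j))
      ≤ ∑ j ∈ Finset.range m, (Φ ((N + j : ℝ) * h) - Φ ((N + (j + 1 : ℕ) : ℝ) * h)) :=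
        Finset.sum_le_sum fun j _ ↦ hstep j
    _ = Φ (N * h) - Φ ((N + m : ℝ) * h) := by
        rw [Finset.sum_range_sub' fun j : ℕ ↦ Φ ((N + j : ℝ) * h), Nat.cast_zero, add_zero]
    _ ≤ Φ (N * h) := sub_le_self _ (hΦ_nonneg _ (hpos m))

theorem convexOn_of_hasDerivAt_of_monotoneOn {s : Set ℝ} (hs : Convex ℝ s) (hs' : IsOpen s)
    {f f' : ℝ → ℝ} (hf : ∀ x ∈ s, HasDerivAt f (f' x) x) (hmono : MonotoneOn f' s) :
    ConvexOn ℝ s f := by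
  refine MonotoneOn.convexOn_of_deriv hs
    (fun x hx ↦ (hf x hx).continuousAt.continuousWithinAt) ?_ ?_ <;> rw [hs'.interior_eq]
  · exact fun x hx ↦ (hf x hx).differentiableAt.differentiableWithinAt
  · exact hmono.congr fun x hx ↦ (hf x hx).deriv.symm

theorem convexOn_rpow_of_nonpos {p : ℝ} (hp : p ≤ 0) :
    ConvexOn ℝ (Set.Ioi 0) fun x : ℝ ↦ x ^ p := by
  refine convexOn_of_hasDerivAt_of_monotoneOn (convex_Ioi 0) isOpen_Ioi
    (fun x hx ↦ Real.hasDerivAt_rpow_const (Or.inl (ne_of_gt hx))) fun x hx y hy hxy ↦ ?_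
  exact mul_le_mul_of_nonpos_left
    (Real.antitoneOn_rpow_Ioi_of_exponent_nonpos (by linarith) hx hy hxy) hp

theorem sum_midpoint_rpow_tail_le {ω h : ℝ} (hω : 0 < ω) (hh : 0 < h) {N : ℕ} (hN : 0 < N)
    (m : ℕ) :
    ∑ j ∈ Finset.range m, h * (midpointNode h (N + j) ^ (-ω) / midpointNode h (N + j)) ≤
      (N * h) ^ (-ω) / ω := by
  refine le_of_eq_of_le (Finset.sum_congr rfl fun j _ ↦ ?_)
    (sum_midpoint_tail_le_of_convexOn (Φ := fun x ↦ x ^ (-ω) / ω)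
      (convexOn_rpow_of_nonpos (by linarith : -ω - 1 ≤ 0)) (fun x hx ↦ ?_)
      (fun x hx ↦ by positivity) hh hN m)
  · rw [Real.rpow_sub_one (midpointNode_pos hh _).ne']
  · convert! (Real.hasDerivAt_rpow_const (p := -ω) (Or.inl hx.ne')).div_const ω using 1
    field_simp

theorem antitoneOn_exp_neg_mul_add_one :
    AntitoneOn (fun v : ℝ ↦ Real.exp (-v) * (v + 1)) (Set.Ici 0) := by
  intro v (hv : 0 ≤ v) w _ hvw
  have hsplit : Real.exp (-v) = Real.exp (w - v) * Real.exp (-w) := by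
    rw [← Real.exp_add]; ring_nf
  calc Real.exp (-w) * (w + 1) ≤ Real.exp (-w) * ((w - v + 1) * (v + 1)) := by
        gcongr; nlinarith
    _ ≤ Real.exp (-w) * (Real.exp (w - v) * (v + 1)) := by
        gcongr; exact Real.add_one_le_exp _
    _ = Real.exp (-v) * (v + 1) := by rw [hsplit]; ring

theorem hasDerivAt_mul_rpow {l ω x : ℝ} (hx : 0 < x) :
    HasDerivAt (fun x ↦ l * x ^ ω) (ω * (l * x ^ ω) / x) x := by
  convert! (Real.hasDerivAt_rpow_const (p := ω) (Or.inl hx.ne')).const_mul l using 1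
  rw [Real.rpow_sub_one hx.ne']
  ring

theorem convexOn_exp_neg_rpow_mul_one_add_inv_div {l ω : ℝ} (hl : 0 < l) (hω : 0 < ω) :
    ConvexOn ℝ (Set.Ioi 0)
      fun x : ℝ ↦ Real.exp (-(l * x ^ ω)) * (1 + (l * x ^ ω)⁻¹) / x := by
  set χ : ℝ → ℝ := fun v ↦
    ω * (Real.exp (-v) * (v + 1) + Real.exp (-v) * v⁻¹) + Real.exp (-v) * (1 + v⁻¹)
  have hderiv {x : ℝ} (hx : 0 < x) :
      HasDerivAt (fun x ↦ Real.exp (-(l * x ^ ω)) * (1 + (l * x ^ ω)⁻¹) / x)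
        (-(χ (l * x ^ ω) * (x ^ 2)⁻¹)) x := by
    have hv : l * x ^ ω ≠ 0 := by positivity
    have hv' := hasDerivAt_mul_rpow (l := l) (ω := ω) hx
    have hψ := hv'.fun_neg.exp.mul ((hv'.fun_inv hv).const_add 1)
    convert! hψ.div (hasDerivAt_id x) hx.ne' using 1
    simp only [χ, id, Pi.mul_apply]
    field_simp
    ring
  have hχ : AntitoneOn χ (Set.Ioi 0) := fun v (hv : 0 < v) w (hw : 0 < w) hvw ↦ by
    have hexp := antitoneOn_exp_neg_mul_add_one hv.le hw.le hvw
    simp only [χ]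
    gcongr
  have hmono : MonotoneOn (fun x ↦ -(χ (l * x ^ ω) * (x ^ 2)⁻¹)) (Set.Ioi 0) := by
    intro x (hx : 0 < x) y (hy : 0 < y) hxy
    have hv : 0 < l * x ^ ω := by positivity
    have hle : l * x ^ ω ≤ l * y ^ ω := by gcongr
    have hχ_nonneg : 0 ≤ χ (l * x ^ ω) := by positivity
    refine neg_le_neg (mul_le_mul (hχ hv (hv.trans_le hle) hle) ?_ (by positivity) hχ_nonneg)
    gcongr
  exact convexOn_of_hasDerivAt_of_monotoneOn (convex_Ioi 0) isOpen_Ioi (fun x hx ↦ hderiv hx)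
    hmono

theorem sum_midpoint_exp_tail_le {l ω h : ℝ} (hl : 0 < l) (hω : 0 < ω) (hh : 0 < h) {N : ℕ}
    (hN : 0 < N) (m : ℕ) :
    ∑ j ∈ Finset.range m,
        h * (Real.exp (-l * midpointNode h (N + j) ^ ω) / midpointNode h (N + j)) ≤
      Real.exp (-l * (N * h) ^ ω) / (ω * (l * (N * h) ^ ω)) := by
  simp only [neg_mul]
  -- `exp (-l x ^ ω) / x` is not convex for large `ω`, but the slightly larger negative derivative
  -- of `exp (-l x ^ ω) / (ω l x ^ ω)` is.
  refine (Finset.sum_le_sum fun j _ ↦ ?_).trans (sum_midpoint_tail_le_of_convexOn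
    (Φ := fun x ↦ Real.exp (-(l * x ^ ω)) / (ω * (l * x ^ ω)))
    (convexOn_exp_neg_rpow_mul_one_add_inv_div hl hω) (fun x hx ↦ ?_)
    (fun x hx ↦ by positivity) hh hN m)
  · have hu := midpointNode_pos hh (N + j)
    gcongr
    exact le_mul_of_one_le_right (Real.exp_pos _).le (le_add_of_nonneg_right (by positivity))
  · have hv : l * x ^ ω ≠ 0 := by positivity
    have hv' := hasDerivAt_mul_rpow (l := l) (ω := ω) hx
    convert! hv'.fun_neg.exp.div (hv'.const_mul ω) (mul_ne_zero hω.ne' hv) using 1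
    field_simp
    ring

theorem abs_sub_sum_range_le_of_hasSum {f : ℕ → ℝ} {S K : ℝ} (hf : HasSum f S) (N : ℕ)
    (hK : ∀ m, ∑ j ∈ Finset.range m, |f (N + j)| ≤ K) : |S - ∑ n ∈ Finset.range N, f n| ≤ K := by
  refine le_of_tendsto' ((hasSum_nat_add_iff' N).2 hf).tendsto_sum_nat.abs fun m ↦ ?_
  simp only [add_comm _ N]
  exact (Finset.abs_sum_le_sum_abs _ _).trans (hK m)

theorem sum_midpoint_div_le {f w : ℝ → ℝ} {B h : ℝ} (hh : 0 < h) {N : ℕ}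
    (hf : ∀ u, 0 < u → N * h ≤ u → f u ≤ B * w u) (m : ℕ) :
    ∑ j ∈ Finset.range m, h * (f (midpointNode h (N + j)) / midpointNode h (N + j)) ≤
      B * ∑ j ∈ Finset.range m, h * (w (midpointNode h (N + j)) / midpointNode h (N + j)) := by
  rw [Finset.mul_sum]
  refine Finset.sum_le_sum fun j _ ↦ ?_
  have hpos := midpointNode_pos hh (N + j)
  calc h * (f (midpointNode h (N + j)) / midpointNode h (N + j))
      ≤ h * (B * w (midpointNode h (N + j)) / midpointNode h (N + j)) := by
        gcongr
        exact hf _ hpos (mul_le_midpointNode_add hh.le N j)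
    _ = B * (h * (w (midpointNode h (N + j)) / midpointNode h (N + j))) := by ring

/-! ### Poisson summation at half-integer frequencies -/

theorem isBigO_cocompact_comp_mul_add {E : Type*} [Norm E] {f : ℝ → E} {b : ℝ} (hb : 0 ≤ b)
    (hf : f =O[cocompact ℝ] (|·| ^ (-b))) {c : ℝ} (hc : c ≠ 0) (d : ℝ) :
    (fun x ↦ f (c * x + d)) =O[cocompact ℝ] (|·| ^ (-b)) := by
  have htendsto : Tendsto (fun x ↦ c * x + d) (cocompact ℝ) (cocompact ℝ) :=
    ((Homeomorph.mulLeft₀ c hc).trans (Homeomorph.addRight d)).isClosedEmbedding.tendsto_cocompact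
  refine (hf.comp_tendsto htendsto).trans (Asymptotics.IsBigO.of_bound ((|c| / 2) ^ (-b)) ?_)
  have hc' : 0 < |c| := abs_pos.2 hc
  filter_upwards [(tendsto_norm_cocompact_atTop (E := ℝ)).eventually_ge_atTop (2 * |d| / |c|),
    (tendsto_norm_cocompact_atTop (E := ℝ)).eventually_gt_atTop 0] with x hx hx0
  rw [Real.norm_eq_abs] at hx hx0
  have hhalf : |c| / 2 * |x| ≤ |c * x + d| := by
    have htri := abs_sub_abs_le_abs_add (c * x) d
    rw [div_le_iff₀ hc'] at hx
    rw [abs_mul] at htri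
    linarith
  simp only [Function.comp_apply]
  rw [Real.norm_of_nonneg (by positivity), Real.norm_of_nonneg (by positivity),
    ← Real.mul_rpow (by positivity) hx0.le]
  exact Real.rpow_le_rpow_of_nonpos (by positivity) hhalf (neg_nonpos.2 hb)

theorem fourier_comp_mul_right_mul_exp (F : ℝ → ℂ) {T : ℝ} (hT : 0 < T) (c w : ℝ) :
    𝓕 (fun t : ℝ ↦ F (t * T) * cexp (2 * Real.pi * c * t * I)) w = T⁻¹ * 𝓕 F ((w - c) / T) := by
  simp only [Real.fourier_real_eq_integral_exp_smul]
  have hsubst := Measure.integral_comp_mul_right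
    (fun v ↦ cexp (↑(-2 * Real.pi * v * ((w - c) / T)) * I) • F v) T
  rw [abs_of_pos (inv_pos.2 hT), real_smul] at hsubst
  rw [← hsubst]
  refine integral_congr_ae (ae_of_all _ fun t ↦ ?_)
  have hphase : cexp (↑(-2 * Real.pi * (t * T) * ((w - c) / T)) * I) =
      cexp (↑(-2 * Real.pi * t * w) * I) * cexp (2 * Real.pi * c * t * I) := by
    rw [← Complex.exp_add]
    congr 1
    push_cast
    field_simp [ofReal_ne_zero.2 hT.ne']
    ring
  simp only [smul_eq_mul, hphase]
  ring

theorem hasSum_fourier_of_rpow_decay {f : ℝ → ℂ} (hf : Continuous f) {b : ℝ} (hb : 1 < b)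
    (hfO : f =O[cocompact ℝ] (|·| ^ (-b))) (hffO : 𝓕 f =O[cocompact ℝ] (|·| ^ (-b))) (x : ℝ) :
    HasSum (fun n : ℤ ↦ 𝓕 f n * fourier n (x : UnitAddCircle)) (∑' k : ℤ, f (x + k)) := by
  rw [Real.tsum_eq_tsum_fourier_of_rpow_decay hf hb hfO hffO]
  refine Summable.hasSum (Summable.of_norm ?_)
  simpa only [norm_mul, fourier_apply, Circle.norm_coe, mul_one, Function.comp_apply] using
    (summable_of_isBigO (Real.summable_abs_int_rpow hb)
      (hffO.comp_tendsto Int.tendsto_coe_cofinite)).norm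

theorem tsum_neg_one_zpow_mul_comp (F : ℝ → ℂ) {T : ℝ} (hT : T ≠ 0) (x : ℝ) :
    ∑' k : ℤ, (-1) ^ k * F (x + k * T) = cexp (-(Real.pi * (x / T) * I)) *
      ∑' k : ℤ, F ((x / T + k) * T) * cexp (2 * Real.pi * (1 / 2 : ℝ) * (x / T + k : ℝ) * I) := by
  have hpow (k : ℤ) : (-1 : ℂ) ^ k = cexp (Real.pi * I * k) := by
    rw [← exp_pi_mul_I, ← Complex.exp_int_mul, mul_comm]
  rw [← tsum_mul_left]
  refine tsum_congr fun k ↦ ?_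
  rw [hpow, mul_left_comm, ← Complex.exp_add, mul_comm, add_mul, div_mul_cancel₀ x hT]
  congr 2
  push_cast
  ring

/-- Poisson summation for `t ↦ F (t T) exp (π i t)`: the alternating signs on one side become
half-integer frequencies on the other. -/
theorem hasSum_fourier_half_int {F : ℝ → ℂ} (hF : Continuous F) {b : ℝ} (hb : 1 < b)
    (hFO : F =O[cocompact ℝ] (|·| ^ (-b))) (hFFO : 𝓕 F =O[cocompact ℝ] (|·| ^ (-b)))
    {T : ℝ} (hT : 0 < T) (x : ℝ) :
    HasSum (fun n : ℤ ↦ T⁻¹ * (𝓕 F (-((n + 1 / 2) / T)) *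
        cexp (-(2 * Real.pi * ((n + 1 / 2) / T) * x * I))))
      (∑' k : ℤ, (-1) ^ k * F (x + k * T)) := by
  set f : ℝ → ℂ := fun t ↦ F (t * T) * cexp (2 * Real.pi * (1 / 2 : ℝ) * t * I)
  have hfourier (w : ℝ) : 𝓕 f w = T⁻¹ * 𝓕 F ((w - 1 / 2) / T) :=
    fourier_comp_mul_right_mul_exp F hT (1 / 2) w
  have hfO : f =O[cocompact ℝ] (|·| ^ (-b)) := by
    refine Asymptotics.IsBigO.trans (Asymptotics.IsBigO.of_norm_le fun t ↦ ?_)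
      (isBigO_cocompact_comp_mul_add (by linarith) hFO hT.ne' 0).norm_left
    rw [norm_mul, norm_exp, add_zero, mul_comm T]
    simp
  have hffO : 𝓕 f =O[cocompact ℝ] (|·| ^ (-b)) := by
    refine ((isBigO_cocompact_comp_mul_add (by linarith) hFFO (inv_ne_zero hT.ne')
      (-(1 / 2) / T)).const_mul_left (T⁻¹ : ℂ)).congr_left fun w ↦ ?_
    rw [hfourier, ofReal_inv, ← div_eq_inv_mul w, ← add_div, ← sub_eq_add_neg]
  rw [tsum_neg_one_zpow_mul_comp F hT.ne', ← (Equiv.neg ℤ).hasSum_iff]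
  refine ((hasSum_fourier_of_rpow_decay (by fun_prop) hb hfO hffO (x / T)).mul_left
    _).congr_fun fun n ↦ ?_
  have hphase : cexp (-(2 * Real.pi * ((↑(-n) + 1 / 2) / T) * x * I)) =
      cexp (-(Real.pi * (x / T) * I)) * cexp (2 * Real.pi * I * n * (x / T : ℝ) / (1 : ℝ)) := by
    rw [← Complex.exp_add]
    congr 1
    push_cast
    field_simp
    ring
  have hfreq : -((↑(-n) + 1 / 2) / T) = ((n : ℝ) - 1 / 2) / T := by
    push_cast
    ring
  simp only [Function.comp_apply, Equiv.neg_apply]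
  rw [hphase, hfreq, fourier_coe_apply, hfourier]
  ring

theorem fourier_ofReal_neg (F : ℝ → ℝ) (w : ℝ) :
    𝓕 (fun y ↦ (F y : ℂ)) (-w) = (starRingEnd ℂ) (𝓕 (fun y ↦ (F y : ℂ)) w) := by
  simp only [Real.fourier_real_eq_integral_exp_smul, smul_eq_mul]
  rw [← integral_conj]
  refine integral_congr_ae (ae_of_all _ fun y ↦ ?_)
  simp only [map_mul, conj_ofReal, ← Complex.exp_conj, conj_I]
  push_cast
  ring_nf

theorem hasSum_two_mul_re_of_conj_symm {f : ℤ → ℂ} {s : ℂ} (hf : HasSum f s)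
    (hconj : ∀ n : ℕ, f (-(n + 1)) = (starRingEnd ℂ) (f n)) :
    HasSum (fun n : ℕ ↦ 2 * (f n).re) s.re := by
  refine (hasSum_re hf.nat_add_neg_add_one).congr_fun fun n ↦ ?_
  rw [hconj, add_re, conj_re, two_mul]

theorem hasSum_re_fourier_half_nat {F : ℝ → ℝ} (hF : Continuous F) {b : ℝ} (hb : 1 < b)
    (hFO : F =O[cocompact ℝ] (|·| ^ (-b)))
    (hFFO : 𝓕 (fun y ↦ (F y : ℂ)) =O[cocompact ℝ] (|·| ^ (-b))) {T : ℝ} (hT : 0 < T) (x : ℝ) :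
    HasSum (fun n : ℕ ↦ 2 / T * (𝓕 (fun y ↦ (F y : ℂ)) (-((n + 1 / 2) / T)) *
        cexp (-(2 * Real.pi * ((n + 1 / 2) / T) * x * I))).re)
      (∑' k : ℤ, (-1) ^ k * F (x + k * T)) := by
  have hsum := hasSum_fourier_half_int (continuous_ofReal.comp hF) hb
    (F := fun y ↦ (F y : ℂ)) (hFO.norm_left.congr_left fun y ↦ by simp).of_norm_left hFFO hT x
  have hreal : ∑' k : ℤ, (-1) ^ k * (F (x + k * T) : ℂ) =
      ((∑' k : ℤ, (-1) ^ k * F (x + k * T) : ℝ) : ℂ) := by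
    push_cast
    rfl
  have hhalf := hasSum_two_mul_re_of_conj_symm hsum fun n ↦ ?_
  · rw [hreal, ofReal_re] at hhalf
    refine hhalf.congr_fun fun n ↦ ?_
    simp only [Int.cast_natCast]
    rw [re_ofReal_mul]
    ring
  · have hneg : ((-(n + 1) : ℤ) + 1 / 2 : ℝ) / T = -((n + 1 / 2) / T) := by push_cast; ring
    have hconj : cexp (-(2 * Real.pi * ((↑(-(n + 1 : ℤ)) + 1 / 2) / T) * x * I)) =
        (starRingEnd ℂ) (cexp (-(2 * Real.pi * ((n + 1 / 2) / T) * x * I))) := by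
      rw [← Complex.exp_conj]
      simp only [map_neg, map_mul, map_div₀, map_add, map_one, map_ofNat, conj_ofReal, conj_I,
        map_natCast]
      push_cast
      ring_nf
    simp only [map_mul, conj_ofReal, Int.cast_natCast]
    rw [hneg, fourier_ofReal_neg, hconj]

theorem integrable_of_continuous_of_isBigO_cocompact {f : ℝ → ℂ} (hf : Continuous f) {b : ℝ}
    (hb : 1 < b) (hfO : f =O[cocompact ℝ] (|·| ^ (-b))) : Integrable f := by
  have hint : Integrable fun x : ℝ ↦ (1 + ‖x‖) ^ (-b) := integrable_one_add_norm (by simpa using hb)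
  have hO : (fun x : ℝ ↦ |x| ^ (-b)) =O[cocompact ℝ] fun x : ℝ ↦ (1 + ‖x‖) ^ (-b) := by
    refine .of_bound (2 ^ b) ?_
    filter_upwards [tendsto_norm_cocompact_atTop.eventually_ge_atTop 1] with x hx
    rw [Real.norm_of_nonneg (by positivity), Real.norm_of_nonneg (by positivity)]
    rw [Real.norm_eq_abs] at hx ⊢
    calc |x| ^ (-b) = 2 ^ b * (2 * |x|) ^ (-b) := by
          rw [Real.mul_rpow two_pos.le (abs_nonneg x), ← mul_assoc, ← Real.rpow_add two_pos,
            add_neg_cancel, Real.rpow_zero, one_mul]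
      _ ≤ 2 ^ b * (1 + |x|) ^ (-b) := by
          gcongr 2 ^ b * ?_
          exact Real.rpow_le_rpow_of_nonpos (by positivity) (by linarith) (by linarith)
  exact hf.locallyIntegrable.integrable_of_isBigO_cocompact (hfO.trans hO)
    (hint.integrableAtFilter _)

theorem continuous_fourier {f : ℝ → ℂ} (hf : Integrable f) : Continuous (𝓕 f) :=
  VectorFourier.fourierIntegral_continuous Real.continuous_fourierChar
    (by exact continuous_inner) hf

theorem continuous_of_integrable_fourier {f : ℝ → ℂ} (hf : Integrable f) (hf' : Integrable (𝓕 f))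
    (hright : ∀ x, ContinuousWithinAt f (Set.Ioi x) x) (hdense : Dense {x | ContinuousAt f x}) :
    Continuous f := by
  have hinv : Continuous (𝓕⁻ (𝓕 f)) := by
    rw [show 𝓕⁻ (𝓕 f) = fun w ↦ 𝓕 (𝓕 f) (-w) from funext (Real.fourierInv_eq_fourier_neg _)]
    exact (continuous_fourier hf').comp continuous_neg
  suffices f = 𝓕⁻ (𝓕 f) by rwa [this]
  ext x
  refine tendsto_nhds_unique_of_frequently_eq (hright x) hinv.continuousWithinAt
    (frequently_iff.2 fun hU ↦ ?_)
  obtain ⟨c, hc, hcU⟩ := mem_nhdsGT_iff_exists_Ioo_subset.1 hU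
  obtain ⟨y, hy, hyc⟩ := hdense.exists_mem_open isOpen_Ioo (Set.nonempty_Ioo.2 hc)
  exact ⟨y, hcU hyc, (hf.fourierInv_fourier_eq hf' hy).symm⟩

/-! ### The damped distribution function -/

theorem residueTerm_of_pos {a : ℝ} (ha : 0 < a) : residueTerm a = 0 := if_pos ha

theorem residueTerm_of_neg {a : ℝ} (ha : a < 0) : residueTerm a = 1 := if_neg ha.not_gt

/-- The distribution function of `μ`, minus `residueTerm a`, damped by `exp (-a y)`; the constant
`residueTerm a` is the one for which the product decays at both ends. -/
noncomputable def dampedCdf (μ : Measure ℝ) (a y : ℝ) : ℝ :=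
  Real.exp (-a * y) * (cdf μ y - residueTerm a)

/-- The function `dampedCdf` of the unit mass at `z`. -/
noncomputable def dampedStep (a z y : ℝ) : ℝ :=
  Real.exp (-a * y) * ((Set.Ici z).indicator 1 y - residueTerm a)

theorem dampedStep_of_pos {a : ℝ} (ha : 0 < a) (z : ℝ) :
    dampedStep a z = (Set.Ici z).indicator fun y ↦ Real.exp (-a * y) := by
  ext y
  by_cases hy : z ≤ y <;> simp [dampedStep, residueTerm_of_pos ha, hy]

theorem dampedStep_of_neg {a : ℝ} (ha : a < 0) (z : ℝ) :
    dampedStep a z = (Set.Iio z).indicator fun y ↦ -Real.exp (-a * y) := by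
  ext y
  by_cases hy : z ≤ y
  · simp [dampedStep, residueTerm_of_neg ha, hy]
  · simp [dampedStep, residueTerm_of_neg ha, hy, not_le.1 hy]

theorem abs_dampedStep {a : ℝ} (ha : a ≠ 0) (z y : ℝ) :
    |dampedStep a z y| = SignType.sign a * dampedStep a z y := by
  rcases ha.lt_or_gt with ha | ha
  · rw [dampedStep_of_neg ha, sign_neg ha]
    by_cases hy : y < z <;> simp [hy]
  · rw [dampedStep_of_pos ha, sign_pos ha]
    by_cases hy : z ≤ y <;> simp [hy]

theorem measurable_dampedStep (a : ℝ) :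
    Measurable (Function.uncurry fun y z : ℝ ↦ dampedStep a z y) := by
  have hle : Measurable fun p : ℝ × ℝ ↦ (Set.Ici p.2).indicator (1 : ℝ → ℝ) p.1 :=
    Measurable.ite (measurableSet_le measurable_snd measurable_fst) measurable_const
      measurable_const
  exact Measurable.mul (by fun_prop) (hle.sub_const _)

theorem integrable_dampedStep {a : ℝ} (ha : a ≠ 0) (z : ℝ) : Integrable (dampedStep a z) := by
  rcases ha.lt_or_gt with ha | ha
  · rw [dampedStep_of_neg ha, integrable_indicator_iff measurableSet_Iio]
    exact ((integrableOn_exp_mul_Iic (neg_pos.2 ha) z).mono_set Set.Iio_subset_Iic_self).neg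
  · rw [dampedStep_of_pos ha, integrable_indicator_iff measurableSet_Ici,
      integrableOn_Ici_iff_integrableOn_Ioi]
    exact integrableOn_exp_mul_Ioi (neg_lt_zero.2 ha) z

theorem integral_dampedStep_mul_cexp {a : ℝ} (ha : a ≠ 0) (z u : ℝ) :
    ∫ y, dampedStep a z y * cexp (u * y * I) = cexp (-(a - u * I) * z) / (a - u * I) := by
  have hexp (y : ℝ) : cexp (-(a - u * I) * y) = Real.exp (-a * y) * cexp (u * y * I) := by
    rw [ofReal_exp, ← Complex.exp_add]
    push_cast
    ring_nf
  rcases ha.lt_or_gt with ha | ha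
  · have hind : (fun y ↦ dampedStep a z y * cexp (u * y * I)) =
        (Set.Iio z).indicator fun y : ℝ ↦ -cexp (-(a - u * I) * y) := by
      ext y
      rw [dampedStep_of_neg ha, Set.indicator_apply, Set.indicator_apply, hexp]
      split_ifs <;> simp
    rw [hind, integral_indicator measurableSet_Iio, ← integral_Iic_eq_integral_Iio, integral_neg,
      integral_exp_mul_complex_Iic (by simpa using ha), div_neg, neg_neg]
  · have hind : (fun y ↦ dampedStep a z y * cexp (u * y * I)) =
        (Set.Ici z).indicator fun y : ℝ ↦ cexp (-(a - u * I) * y) := by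
      ext y
      rw [dampedStep_of_pos ha, Set.indicator_apply, Set.indicator_apply, hexp]
      split_ifs <;> simp
    rw [hind, integral_indicator measurableSet_Ici, integral_Ici_eq_integral_Ioi,
      integral_exp_mul_complex_Ioi (by simpa using ha), neg_div_neg_eq]

theorem integral_abs_dampedStep {a : ℝ} (ha : a ≠ 0) (z : ℝ) :
    ∫ y, |dampedStep a z y| = SignType.sign a / a * Real.exp (-a * z) := by
  have hint : ∫ y, dampedStep a z y = Real.exp (-a * z) / a := by
    apply ofReal_injective
    simpa [← integral_complex_ofReal] using integral_dampedStep_mul_cexp ha z 0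
  simp_rw [abs_dampedStep ha, integral_const_mul, hint]
  ring

theorem integrable_uncurry_dampedStep {μ : Measure ℝ} [SFinite μ] {a : ℝ} (ha : a ≠ 0)
    (hμ : -a ∈ integrableExpSet id μ) :
    Integrable (Function.uncurry fun y z : ℝ ↦ dampedStep a z y) (volume.prod μ) := by
  rw [integrable_prod_iff' (measurable_dampedStep a).aestronglyMeasurable]
  refine ⟨ae_of_all _ fun z ↦ integrable_dampedStep ha z, ?_⟩
  simp only [Function.uncurry, Real.norm_eq_abs, integral_abs_dampedStep ha]
  exact Integrable.const_mul hμ _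

variable {μ : Measure ℝ} {a : ℝ}

theorem abs_dampedCdf (ha : a ≠ 0) (y : ℝ) :
    |dampedCdf μ a y| = SignType.sign a * dampedCdf μ a y := by
  rcases ha.lt_or_gt with ha | ha
  · rw [sign_neg ha, abs_of_nonpos]
    · simp
    · rw [dampedCdf, residueTerm_of_neg ha]
      exact mul_nonpos_of_nonneg_of_nonpos (Real.exp_pos _).le (sub_nonpos.2 (cdf_le_one μ y))
  · rw [sign_pos ha, abs_of_nonneg]
    · simp
    · rw [dampedCdf, residueTerm_of_pos ha, sub_zero]
      exact mul_nonneg (Real.exp_pos _).le (cdf_nonneg μ y)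

theorem abs_dampedCdf_le_exp_neg (a y : ℝ) : |dampedCdf μ a y| ≤ Real.exp (-a * y) := by
  have hcdf : |cdf μ y - residueTerm a| ≤ 1 := by
    have h0 := cdf_nonneg μ y
    have h1 := cdf_le_one μ y
    rw [abs_le, residueTerm]
    split_ifs <;> constructor <;> linarith
  rw [dampedCdf, abs_mul, Real.abs_exp]
  exact mul_le_of_le_one_right (Real.exp_pos _).le hcdf

theorem cdf_sub_cdfApprox {φ : ℂ → ℂ} (hφ : ∀ u : ℝ, φ (u + I * a) = complexMGF id μ (-(a - u * I)))
    (h : ℝ) (N : ℕ) (x : ℝ) :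
    cdf μ x - cdfApprox φ a h N x = Real.exp (a * x) * (dampedCdf μ a x -
      ∑ n ∈ Finset.range N, h / Real.pi * (complexMGF id μ (-(a - midpointNode h n * I)) /
        (a - midpointNode h n * I) * cexp (-(I * x * midpointNode h n))).re) := by
  have hden (u : ℝ) : I * (u + I * a) = -(a - u * I) := by linear_combination (a : ℂ) * I_mul_I
  have hdamp : Real.exp (a * x) * dampedCdf μ a x = cdf μ x - residueTerm a := by
    rw [dampedCdf, ← mul_assoc, ← Real.exp_add]
    simp
  simp only [cdfApprox, hφ, hden, div_neg, neg_mul, Finset.sum_neg_distrib, neg_re, re_sum,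
    ← Finset.mul_sum, mul_sub, hdamp]
  ring

variable [IsProbabilityMeasure μ]

theorem dampedCdf_eq_integral (a y : ℝ) : dampedCdf μ a y = ∫ z, dampedStep a z y ∂μ := by
  have hind : (fun z ↦ (Set.Ici z).indicator (1 : ℝ → ℝ) y) = (Set.Iic y).indicator 1 := by
    ext z
    simp [Set.indicator_apply]
  simp only [dampedStep]
  rw [integral_const_mul, integral_sub _ (integrable_const _), hind,
    integral_indicator_one measurableSet_Iic, integral_const, probReal_univ, one_smul, dampedCdf,
    cdf_eq_real]
  rw [hind]
  exact (integrable_const 1).indicator measurableSet_Iic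

theorem integrable_dampedCdf (ha : a ≠ 0) (hμ : -a ∈ integrableExpSet id μ) :
    Integrable (dampedCdf μ a) := by
  simpa only [Function.uncurry, ← dampedCdf_eq_integral] using
    (integrable_uncurry_dampedStep ha hμ).integral_prod_left

theorem integral_dampedCdf_mul_cexp (ha : a ≠ 0) (hμ : -a ∈ integrableExpSet id μ) (u : ℝ) :
    ∫ y, dampedCdf μ a y * cexp (u * y * I) = complexMGF id μ (-(a - u * I)) / (a - u * I) := by
  have hint : Integrable (Function.uncurry fun y z : ℝ ↦ dampedStep a z y * cexp (u * y * I))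
      (volume.prod μ) := by
    refine (integrable_uncurry_dampedStep ha hμ).ofReal.mul_bdd (c := 1) (by fun_prop)
      (ae_of_all _ fun p ↦ ?_)
    exact_mod_cast (norm_exp_ofReal_mul_I (u * p.1)).le
  calc ∫ y, dampedCdf μ a y * cexp (u * y * I)
      = ∫ y : ℝ, ∫ z : ℝ, dampedStep a z y * cexp (u * y * I) ∂μ := by
        simp only [integral_mul_const, integral_complex_ofReal, dampedCdf_eq_integral]
    _ = ∫ z : ℝ, cexp (-(a - u * I) * z) / (a - u * I) ∂μ := by
        rw [integral_integral_swap hint]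
        simp only [integral_dampedStep_mul_cexp ha]
    _ = complexMGF id μ (-(a - u * I)) / (a - u * I) := integral_div _ _

theorem fourier_dampedCdf (ha : a ≠ 0) (hμ : -a ∈ integrableExpSet id μ) (w : ℝ) :
    𝓕 (fun y ↦ (dampedCdf μ a y : ℂ)) w =
      complexMGF id μ (-(a - (-2 * Real.pi * w : ℝ) * I)) / (a - (-2 * Real.pi * w : ℝ) * I) := by
  rw [Real.fourier_real_eq_integral_exp_smul, ← integral_dampedCdf_mul_cexp ha hμ]
  congr 1 with y
  rw [smul_eq_mul, mul_comm]
  push_cast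
  ring_nf

theorem cdf_le_exp_mul_mgf {t : ℝ} (ht : t ≤ 0) (hμ : t ∈ integrableExpSet id μ) (y : ℝ) :
    cdf μ y ≤ Real.exp (-t * y) * mgf id μ t := by
  rw [cdf_eq_real]
  exact measure_le_le_exp_mul_mgf y ht hμ

theorem one_sub_cdf_le_exp_mul_mgf {t : ℝ} (ht : 0 ≤ t) (hμ : t ∈ integrableExpSet id μ) (y : ℝ) :
    1 - cdf μ y ≤ Real.exp (-t * y) * mgf id μ t := by
  rw [cdf_eq_real, ← probReal_compl_eq_one_sub measurableSet_Iic, Set.compl_Iic]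
  exact (measureReal_mono Set.Ioi_subset_Ici_self).trans (measure_ge_le_exp_mul_mgf y ht hμ)

theorem abs_dampedCdf_le_exp_mul_mgf (ha : a ≠ 0) (hμ : -(2 * a) ∈ integrableExpSet id μ) (y : ℝ) :
    |dampedCdf μ a y| ≤ Real.exp (a * y) * mgf id μ (-(2 * a)) := by
  have hcdf : |cdf μ y - residueTerm a| ≤ Real.exp (-(-(2 * a)) * y) * mgf id μ (-(2 * a)) := by
    rcases ha.lt_or_gt with ha | ha
    · rw [residueTerm_of_neg ha, abs_sub_comm, abs_of_nonneg (sub_nonneg.2 (cdf_le_one μ y))]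
      exact one_sub_cdf_le_exp_mul_mgf (by linarith) hμ y
    · rw [residueTerm_of_pos ha, sub_zero, abs_of_nonneg (cdf_nonneg μ y)]
      exact cdf_le_exp_mul_mgf (by linarith) hμ y
  calc |dampedCdf μ a y| = Real.exp (-a * y) * |cdf μ y - residueTerm a| := by
        rw [dampedCdf, abs_mul, Real.abs_exp]
    _ ≤ Real.exp (-a * y) * (Real.exp (-(-(2 * a)) * y) * mgf id μ (-(2 * a))) := by gcongr
    _ = Real.exp (a * y) * mgf id μ (-(2 * a)) := by
        rw [← mul_assoc, ← Real.exp_add]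
        ring_nf

theorem isBigO_exp_neg_abs {c : ℝ} (hc : 0 < c) (b : ℝ) :
    (fun x : ℝ ↦ Real.exp (-c * |x|)) =O[cocompact ℝ] (|·| ^ b) :=
  (isLittleO_exp_neg_mul_rpow_atTop hc b).isBigO.comp_tendsto
    (tendsto_norm_cocompact_atTop (E := ℝ))

theorem abs_dampedCdf_le_exp_neg_abs (ha : a ≠ 0) (hμ : -(2 * a) ∈ integrableExpSet id μ)
    (y : ℝ) :
    |dampedCdf μ a y| ≤ max 1 (mgf id μ (-(2 * a))) * Real.exp (-|a| * |y|) := by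
  rw [neg_mul |a|, ← abs_mul]
  rcases le_total 0 (a * y) with h | h
  · rw [abs_of_nonneg h, ← neg_mul a]
    exact (abs_dampedCdf_le_exp_neg a y).trans
      (le_mul_of_one_le_left (Real.exp_pos _).le (le_max_left _ _))
  · rw [abs_of_nonpos h, neg_neg, mul_comm]
    exact (abs_dampedCdf_le_exp_mul_mgf ha hμ y).trans (by gcongr; exact le_max_right _ _)

theorem isBigO_dampedCdf (ha : a ≠ 0) (hμ : -(2 * a) ∈ integrableExpSet id μ) (b : ℝ) :
    dampedCdf μ a =O[cocompact ℝ] (|·| ^ b) := by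
  refine .trans (.of_bound (max 1 (mgf id μ (-(2 * a)))) (.of_forall fun y ↦ ?_))
    (isBigO_exp_neg_abs (abs_pos.2 ha) b)
  rw [Real.norm_eq_abs, Real.norm_eq_abs, Real.abs_exp]
  exact abs_dampedCdf_le_exp_neg_abs ha hμ y

theorem isBigO_fourier_dampedCdf (ha : a ≠ 0) (hμ : -a ∈ integrableExpSet id μ) {ω : ℝ}
    (hω : 0 < ω)
    (hdecay : (fun u : ℝ ↦ complexMGF id μ (-(a - u * I))) =O[cocompact ℝ] (|·| ^ (-ω))) :
    𝓕 (fun y ↦ (dampedCdf μ a y : ℂ)) =O[cocompact ℝ] (|·| ^ (-(1 + ω))) := by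
  have hinv : (fun u : ℝ ↦ (a - u * I : ℂ)⁻¹) =O[cocompact ℝ] fun u ↦ |u| ^ (-1 : ℝ) := by
    refine .of_norm_eventuallyLE ?_
    filter_upwards [tendsto_norm_cocompact_atTop.eventually_gt_atTop 0] with u hu
    rw [norm_inv, Real.rpow_neg_one]
    exact inv_anti₀ hu (by simpa using abs_im_le_norm (a - u * I : ℂ))
  have hquot : (fun u : ℝ ↦ complexMGF id μ (-(a - u * I)) / (a - u * I)) =O[cocompact ℝ]
      (|·| ^ (-(1 + ω))) := by
    refine (hdecay.mul hinv).congr' (.of_forall fun u ↦ (div_eq_mul_inv _ _).symm) ?_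
    filter_upwards [tendsto_norm_cocompact_atTop.eventually_gt_atTop 0] with u hu
    rw [← Real.rpow_add (by simpa using hu), neg_add_rev]
  have hscale : -2 * Real.pi ≠ 0 := by simp [Real.pi_ne_zero]
  refine (isBigO_cocompact_comp_mul_add (by positivity) hquot hscale 0).congr_left fun w ↦ ?_
  rw [fourier_dampedCdf ha hμ, add_zero]

theorem continuous_dampedCdf (ha : a ≠ 0) (hμ : -a ∈ integrableExpSet id μ)
    (hint : Integrable (𝓕 fun y ↦ (dampedCdf μ a y : ℂ))) : Continuous (dampedCdf μ a) := by
  have hcdf : Dense {y | ¬ContinuousAt (cdf μ) y}ᶜ :=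
    (monotone_cdf μ).countable_not_continuousAt.dense_compl ℝ
  have hcts : Continuous fun y ↦ (dampedCdf μ a y : ℂ) := by
    refine continuous_of_integrable_fourier (integrable_dampedCdf ha hμ).ofReal hint (fun x ↦ ?_)
      (hcdf.mono fun y hy ↦ ?_)
    · exact continuous_ofReal.continuousAt.comp_continuousWithinAt
        ((by fun_prop : Continuous fun y ↦ Real.exp (-a * y)).continuousWithinAt.mul
          ((((cdf μ).right_continuous x).mono Set.Ioi_subset_Ici_self).sub
            continuousWithinAt_const))
    · exact continuous_ofReal.continuousAt.comp
        ((by fun_prop : Continuous fun y ↦ Real.exp (-a * y)).continuousAt.mul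
          ((not_not.1 hy).sub continuousAt_const))
  exact continuous_re.comp hcts

/-! ### Truncation and discretisation errors -/

theorem abs_re_div_mul_cexp_le (w : ℂ) (a x : ℝ) {u : ℝ} (hu : 0 < u) :
    |(w / (a - u * I) * cexp (-(I * x * u))).re| ≤ ‖w‖ / u := by
  have hphase : ‖cexp (-(I * x * u))‖ = 1 := by simp [norm_exp]
  have hden : u ≤ ‖(a - u * I : ℂ)‖ := by
    simpa [abs_of_pos hu] using abs_im_le_norm (a - u * I : ℂ)
  calc |(w / (a - u * I) * cexp (-(I * x * u))).re| ≤ ‖w / (a - u * I) * cexp (-(I * x * u))‖ :=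
        abs_re_le_norm _
    _ = ‖w‖ / ‖(a - u * I : ℂ)‖ := by rw [norm_mul, hphase, mul_one, norm_div]
    _ ≤ ‖w‖ / u := by gcongr

theorem exp_mul_eq_discretisationBound {φ : ℂ → ℂ} {a h : ℝ} (ha : a ≠ 0) (hh : 0 < h) (x : ℝ) :
    Real.exp (a * x) * ((Real.exp (-a * x) + Real.exp (a * x) * (φ (2 * I * a)).re) *
      (Real.exp (-|a| * (2 * Real.pi / h)) / (1 - Real.exp (-|a| * (2 * Real.pi / h)) ^ 2))) =
      discretisationBound φ a h x := by
  have hnum : Real.exp (a * x) * (Real.exp (-a * x) + Real.exp (a * x) * (φ (2 * I * a)).re) =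
      1 + Real.exp (2 * a * x) * (φ (2 * I * a)).re := by
    rw [mul_add, ← mul_assoc, ← Real.exp_add, ← Real.exp_add]
    ring_nf
    simp
  have hq : 1 < Real.exp (2 * Real.pi * |a| / h) := Real.one_lt_exp_iff.2 (by positivity)
  have harg : -|a| * (2 * Real.pi / h) = -(2 * Real.pi * |a| / h) := by ring
  rw [← mul_assoc, hnum, discretisationBound, mul_comm (1 / _), harg, Real.exp_neg]
  congr 1
  have : Real.exp (2 * Real.pi * |a| / h) ^ 2 - 1 ≠ 0 := by nlinarith
  field_simp

theorem PowerLawDecay.isBigO {φ : ℂ → ℂ} {a B ω U : ℝ} (hφ : PowerLawDecay φ a B ω U) :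
    (fun u : ℝ ↦ φ (u + I * a)) =O[cocompact ℝ] (|·| ^ (-ω)) := by
  refine .of_bound B ?_
  filter_upwards [tendsto_norm_cocompact_atTop.eventually_ge_atTop U,
    tendsto_norm_cocompact_atTop.eventually_gt_atTop 0] with u hU h0
  rw [Real.norm_of_nonneg (by positivity)]
  exact (hφ u (norm_pos_iff.1 h0) hU).le

theorem ExponentialDecay.isBigO {φ : ℂ → ℂ} {a B l ω U : ℝ} (hl : 0 < l) (hω : 0 < ω)
    (hφ : ExponentialDecay φ a B l ω U) :
    (fun u : ℝ ↦ φ (u + I * a)) =O[cocompact ℝ] (|·| ^ (-ω)) := by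
  have hexp : (fun u : ℝ ↦ Real.exp (-l * |u| ^ ω)) =O[cocompact ℝ] fun u ↦ |u| ^ (-ω) := by
    have := (isLittleO_exp_neg_mul_rpow_atTop hl (-1)).isBigO.comp_tendsto
      ((tendsto_rpow_atTop hω).comp (tendsto_norm_cocompact_atTop (E := ℝ)))
    refine this.congr_right fun u ↦ ?_
    rw [Function.comp_apply, Function.comp_apply, ← Real.rpow_mul (norm_nonneg u), mul_neg_one,
      Real.norm_eq_abs]
  refine .trans (.of_bound B ?_) hexp
  filter_upwards [tendsto_norm_cocompact_atTop.eventually_ge_atTop U] with u hU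
  rw [Real.norm_of_nonneg (Real.exp_pos _).le]
  exact (hφ u hU).le

theorem hasSum_midpoint_dampedCdf (ha : a ≠ 0) (hμ : -a ∈ integrableExpSet id μ)
    (hμ2 : -(2 * a) ∈ integrableExpSet id μ) {ω : ℝ} (hω : 0 < ω)
    (hdecay : (fun u : ℝ ↦ complexMGF id μ (-(a - u * I))) =O[cocompact ℝ] (|·| ^ (-ω)))
    {h : ℝ} (hh : 0 < h) (x : ℝ) :
    HasSum (fun n ↦ h / Real.pi * (complexMGF id μ (-(a - midpointNode h n * I)) /
        (a - midpointNode h n * I) * cexp (-(I * x * midpointNode h n))).re)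
      (∑' k : ℤ, (-1) ^ k * dampedCdf μ a (x + k * (2 * Real.pi / h))) := by
  have hω' : 1 < 1 + ω := by linarith
  have hfourier := isBigO_fourier_dampedCdf ha hμ hω hdecay
  have hint : Integrable (𝓕 fun y ↦ (dampedCdf μ a y : ℂ)) :=
    integrable_of_continuous_of_isBigO_cocompact
      (continuous_fourier (integrable_dampedCdf ha hμ).ofReal) hω' hfourier
  have hsum := hasSum_re_fourier_half_nat (continuous_dampedCdf ha hμ hint) hω'
    (isBigO_dampedCdf ha hμ2 _) hfourier (T := 2 * Real.pi / h) (by positivity) x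
  refine hsum.congr_fun fun n ↦ ?_
  have hnode : -2 * Real.pi * -((n + 1 / 2) / (2 * Real.pi / h)) = midpointNode h n := by
    rw [midpointNode]
    field_simp
  have hphase : 2 * Real.pi * ((n + 1 / 2) / ((2 * Real.pi / h : ℝ) : ℂ)) * x * I =
      I * x * midpointNode h n := by
    rw [← hnode]
    push_cast
    ring
  have hweight : 2 / (2 * Real.pi / h) = h / Real.pi := by field_simp
  rw [fourier_dampedCdf ha hμ, hnode, hphase, hweight]

theorem abs_dampedCdf_add_add_abs_dampedCdf_sub_le (ha : a ≠ 0)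
    (hμ : -(2 * a) ∈ integrableExpSet id μ) (x s : ℝ) :
    |dampedCdf μ a (x + s)| + |dampedCdf μ a (x - s)| ≤
      (Real.exp (-a * x) + Real.exp (a * x) * mgf id μ (-(2 * a))) * Real.exp (-|a| * s) := by
  have hleft (t : ℝ) : |dampedCdf μ a (x + t)| ≤ Real.exp (-a * x) * Real.exp (-a * t) := by
    rw [← Real.exp_add, ← mul_add]
    exact abs_dampedCdf_le_exp_neg a _
  have hright (t : ℝ) : |dampedCdf μ a (x + t)| ≤
      Real.exp (a * x) * mgf id μ (-(2 * a)) * Real.exp (a * t) := by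
    rw [mul_right_comm, ← Real.exp_add, ← mul_add]
    exact abs_dampedCdf_le_exp_mul_mgf ha hμ _
  rw [add_mul, sub_eq_add_neg]
  rcases ha.lt_or_gt with ha | ha
  · rw [abs_of_neg ha, neg_neg, add_comm]
    simpa only [neg_mul_neg] using add_le_add (hleft (-s)) (hright s)
  · rw [abs_of_pos ha]
    simpa only [mul_neg, neg_mul] using add_le_add (hleft s) (hright (-s))

theorem abs_tsum_neg_one_zpow_mul_dampedCdf_sub_le (ha : a ≠ 0)
    (hμ : -(2 * a) ∈ integrableExpSet id μ) {T : ℝ} (hT : 0 < T) (x : ℝ) :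
    |∑' k : ℤ, (-1) ^ k * dampedCdf μ a (x + k * T) - dampedCdf μ a x| ≤
      (Real.exp (-a * x) + Real.exp (a * x) * mgf id μ (-(2 * a))) *
        (Real.exp (-|a| * T) / (1 - Real.exp (-|a| * T) ^ 2)) := by
  have hsign : |(SignType.sign a : ℝ)| = 1 := by rcases ha.lt_or_gt with ha | ha <;> simp [ha]
  have hq : Real.exp (-|a| * T) < 1 := by
    rw [Real.exp_lt_one_iff, neg_mul, neg_lt_zero]
    positivity
  have habs := abs_tsum_neg_one_zpow_mul_sub_le (c := fun k ↦ |dampedCdf μ a (x + k * T)|)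
    (Real.exp_pos _) hq (fun _ ↦ abs_nonneg _) fun n ↦ by
      have hpow : Real.exp (-|a| * T) ^ (n + 1) = Real.exp (-|a| * ((n + 1) * T)) := by
        rw [← Real.exp_nat_mul]
        push_cast
        ring_nf
      rw [hpow]
      push_cast
      rw [neg_mul, ← sub_eq_add_neg]
      exact abs_dampedCdf_add_add_abs_dampedCdf_sub_le ha hμ x _
  simp only [abs_dampedCdf ha, mul_left_comm _ (SignType.sign a : ℝ)] at habs
  rw [tsum_mul_left, ← mul_sub, abs_mul, hsign, one_mul, Int.cast_zero, zero_mul, add_zero] at habs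
  exact habs

variable {pₗ pᵤ : EReal} {φ : ℂ → ℂ}

theorem IsCharFunOnStrip.apply_two_mul_I_mul (hφ : IsCharFunOnStrip μ pₗ pᵤ φ)
    (hl : pₗ / 2 < a) (hu : a < pᵤ / 2) : φ (2 * I * a) = mgf id μ (-(2 * a)) := by
  have heq := (hφ.eq_complexMGF (lt_and_lt_two_mul_of_div_two_lt hφ.neg hl).2
    (lt_and_two_mul_lt_of_lt_div_two hφ.pos hu).2).2 0
  rw [← complexMGF_ofReal]
  convert heq using 2 <;> push_cast <;> ring

theorem IsCharFunOnStrip.abs_cdf_sub_cdfApprox_le (hφ : IsCharFunOnStrip μ pₗ pᵤ φ) (ha : a ≠ 0)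
    (hl : pₗ / 2 < a) (hu : a < pᵤ / 2) {ω : ℝ} (hω : 0 < ω)
    (hdecay : (fun u : ℝ ↦ φ (u + I * a)) =O[cocompact ℝ] (|·| ^ (-ω))) {h : ℝ} (hh : 0 < h)
    {N : ℕ} {K : ℝ}
    (hK : ∀ m, ∑ j ∈ Finset.range m,
      h * (‖φ (midpointNode h (N + j) + I * a)‖ / midpointNode h (N + j)) ≤ K) (x : ℝ) :
    |cdf μ x - cdfApprox φ a h N x| ≤ Real.exp (a * x) / Real.pi * K +
      discretisationBound φ a h x := by
  obtain ⟨hla, hl2⟩ := lt_and_lt_two_mul_of_div_two_lt hφ.neg hl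
  obtain ⟨hua, hu2⟩ := lt_and_two_mul_lt_of_lt_div_two hφ.pos hu
  obtain ⟨hμ, heq⟩ := hφ.eq_complexMGF hla hua
  obtain ⟨hμ2, -⟩ := hφ.eq_complexMGF hl2 hu2
  simp only [heq] at hdecay hK
  have halias := abs_tsum_neg_one_zpow_mul_dampedCdf_sub_le ha hμ2
    (T := 2 * Real.pi / h) (by positivity) x
  rw [abs_sub_comm] at halias
  have htrunc := abs_sub_sum_range_le_of_hasSum (hasSum_midpoint_dampedCdf ha hμ hμ2 hω hdecay hh x)
    N (K := K / Real.pi) fun m ↦ by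
      refine le_trans ?_ (div_le_div_of_nonneg_right (hK m) Real.pi_pos.le)
      rw [Finset.sum_div]
      refine Finset.sum_le_sum fun j _ ↦ ?_
      rw [abs_mul, abs_of_pos (div_pos hh Real.pi_pos), mul_div_right_comm]
      gcongr
      exact abs_re_div_mul_cexp_le _ a x (midpointNode_pos hh _)
  rw [cdf_sub_cdfApprox heq, abs_mul, Real.abs_exp]
  refine (mul_le_mul_of_nonneg_left ((abs_sub_le _ _ _).trans (add_le_add halias htrunc))
    (Real.exp_pos _).le).trans_eq ?_
  rw [mul_add, ← exp_mul_eq_discretisationBound ha hh, hφ.apply_two_mul_I_mul hl hu, ofReal_re]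
  ring

theorem IsCharFunOnStrip.abs_cdf_sub_cdfApprox_le_of_exponentialDecay
    (hφ : IsCharFunOnStrip μ pₗ pᵤ φ) (ha : a ≠ 0) (hl : pₗ / 2 < a) (hu : a < pᵤ / 2)
    {B l ω U : ℝ} (hB : 0 ≤ B) (hl0 : 0 < l) (hω : 0 < ω) (hdecay : ExponentialDecay φ a B l ω U)
    {N : ℕ} {h : ℝ} (hN : 0 < N) (hh : 0 < h) (hU : U ≤ N * h) (x : ℝ) :
    |cdf μ x - cdfApprox φ a h N x| ≤
      B * Real.exp (a * x) / (Real.pi * ω) *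
          (Real.exp (-l * (N * h) ^ ω) / (l * (N * h) ^ ω)) + discretisationBound φ a h x := by
  have hbound (u : ℝ) (h0 : 0 < u) (hu : N * h ≤ u) :
      ‖φ (u + I * a)‖ ≤ B * Real.exp (-l * u ^ ω) := by
    simpa only [abs_of_pos h0] using (hdecay u (hU.trans (hu.trans (le_abs_self u)))).le
  refine (hφ.abs_cdf_sub_cdfApprox_le ha hl hu hω (hdecay.isBigO hl0 hω) hh (N := N) (fun m ↦
    (sum_midpoint_div_le hh hbound m).trans
      (mul_le_mul_of_nonneg_left (sum_midpoint_exp_tail_le hl0 hω hh hN m) hB)) x).trans_eq ?_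
  congr 1
  field_simp

theorem IsCharFunOnStrip.abs_cdf_sub_cdfApprox_le_of_powerLawDecay
    (hφ : IsCharFunOnStrip μ pₗ pᵤ φ) (ha : a ≠ 0) (hl : pₗ / 2 < a) (hu : a < pᵤ / 2)
    {B ω U : ℝ} (hB : 0 ≤ B) (hω : 0 < ω) (hdecay : PowerLawDecay φ a B ω U)
    {N : ℕ} {h : ℝ} (hN : 0 < N) (hh : 0 < h) (hU : U ≤ N * h) (x : ℝ) :
    |cdf μ x - cdfApprox φ a h N x| ≤
      B * Real.exp (a * x) / (Real.pi * ω) * (N * h) ^ (-ω) + discretisationBound φ a h x := by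
  have hbound (u : ℝ) (h0 : 0 < u) (hu : N * h ≤ u) : ‖φ (u + I * a)‖ ≤ B * u ^ (-ω) := by
    simpa only [abs_of_pos h0] using (hdecay u h0.ne' (hU.trans (hu.trans (le_abs_self u)))).le
  refine (hφ.abs_cdf_sub_cdfApprox_le ha hl hu hω hdecay.isBigO hh (N := N) (fun m ↦
    (sum_midpoint_div_le hh hbound m).trans
      (mul_le_mul_of_nonneg_left (sum_midpoint_rpow_tail_le hω hh hN m) hB)) x).trans_eq ?_
  congr 1
  field_simp

end

theorem proposition4p1 {Ω : Type*} [MeasurableSpace Ω] (ℙ : Measure Ω) [IsProbabilityMeasure ℙ]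
    (Z : Ω → ℝ) (hZ : AEMeasurable Z ℙ) (pₗ pᵤ : EReal) (φ : ℂ → ℂ)
    (hφ : IsCharFunOnStrip (ℙ.map Z) pₗ pᵤ φ)
    (a : ℝ) (ha₀ : a ≠ 0) (ha_lo : pₗ / 2 < (a : EReal)) (ha_hi : (a : EReal) < pᵤ / 2) :
    (φ (2 * Complex.I * (a : ℂ))).im = 0 ∧
    (∀ B l ω U : ℝ, 0 < B → 0 < l → 0 < ω → ExponentialDecay φ a B l ω U →
      ∀ (N : ℕ) (h : ℝ), 0 < N → 0 < h → U ≤ N * h → ∀ x : ℝ,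
        |ℙ.real {w | Z w ≤ x} - cdfApprox φ a h N x| ≤
          B * Real.exp (a * x) / (Real.pi * ω) *
              (Real.exp (-l * (N * h) ^ ω) / (l * (N * h) ^ ω)) +
            discretisationBound φ a h x) ∧
    (∀ B ω U : ℝ, 0 < B → 0 < ω → PowerLawDecay φ a B ω U →
      ∀ (N : ℕ) (h : ℝ), 0 < N → 0 < h → U ≤ N * h → ∀ x : ℝ,
        |ℙ.real {w | Z w ≤ x} - cdfApprox φ a h N x| ≤
          B * Real.exp (a * x) / (Real.pi * ω) * (N * h) ^ (-ω) +
            discretisationBound φ a h x) := by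
  have : IsProbabilityMeasure (ℙ.map Z) := Measure.isProbabilityMeasure_map hZ
  have hcdf (x : ℝ) : ℙ.real {w | Z w ≤ x} = ProbabilityTheory.cdf (ℙ.map Z) x := by
    rw [ProbabilityTheory.cdf_eq_real, measureReal_def, measureReal_def,
      Measure.map_apply_of_aemeasurable hZ measurableSet_Iic]
    rfl
  simp_rw [hcdf]
  refine ⟨?_, fun B l ω U hB hl hω hdecay N h hN hh hU x ↦ ?_,
    fun B ω U hB hω hdecay N h hN hh hU x ↦ ?_⟩
  · rw [hφ.apply_two_mul_I_mul ha_lo ha_hi, Complex.ofReal_im]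
  · exact hφ.abs_cdf_sub_cdfApprox_le_of_exponentialDecay ha₀ ha_lo ha_hi hB.le hl hω hdecay
      hN hh hU x
  · exact hφ.abs_cdf_sub_cdfApprox_le_of_powerLawDecay ha₀ ha_lo ha_hi hB.le hω hdecay hN hh hU x
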